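/- Let $C$ be a compact connected Riemann surface, $p_\infty\in C$ a point and $z$ a holomorphic local coordinate around $p_\infty$ with $z(p_\infty)=0$. Let $L$ be a holomorphic line bundle on $C$, and let $H^0(C,L(*p_\infty))$ be the space of sections of $L$ that are holomorphic on $C\setminus\{p_\infty\}$ and meromorphic at $p_\infty$. Let $P_1,\dots,P_N,Q_1,\dots,Q_M$ be distinct points of the coordinate neighbourhood, all different from $p_\infty$, put $p_i=z(P_i)$, $q_j=z(Q_j)$, let $(a_{j,i})$ be a complex $M\times N$ matrix and put $$b_{N+j,i}=a_{j,i}\prod_{m\ne i}\frac{p_i^{-1}-p_m^{-1}}{q_j^{-1}-p_m^{-1}},\qquad b'_{N+j,i}=b_{N+j,i}\,p_i^{-1}q_j .$$ Fix frames of the fibres of $L$ at the points $P_i,Q_j$, so that the values $f(p_i),f(q_j)$ of a section $f$ at $P_i,Q_j$ are complex numbers, and set $$W_e=\Bigl\{f\in H^0(C,L(*p_\infty))\ \Big|\ f(p_i)=-\sum_{j=1}^M b'_{N+j,i}f(q_j),\ 1\le i\le N\Bigr\}.$$ Let $R=H^0(C,\mathcal O(*p_\infty))$ be the ring of functions holomorphic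 on $C\setminus\{p_\infty\}$ and meromorphic at $p_\infty$, let $K$ be its quotient field, let $R(n)\subset R$ consist of the functions with a pole of order at most $n$ at $p_\infty$, let $R_e=\{f\in R\mid fW_e\subset W_e\}$ and $R_e(n)=R(n)\cap R_e$. Put $A=\bigoplus_{n\ge0}R(n)$ and $A'=\bigoplus_{n\ge0}R_e(n)$, write $C$ also for the scheme $\operatorname{Proj}A$, and put $C'=\operatorname{Proj}A'$. Then the inclusion $A'\subset A$ induces a morphism $\psi:C\to C'$ defined on all of $C$, the scheme $C'$ is integral, and $\psi$ is the normalization of $C'$; moreover $\psi$ is finite. More precisely, $R$ is a finite $R_e$-module and is the integral closure of $R_e$ in $K$; and for every $m\ge1$ and every $a\in R_e(m)$ with a pole of order exactly $m$ at $p_\infty$, the ring $A_{(a)}=\{ua^{-n}\mid n\ge0,\ u\in R(nm)\}$ is a finite module over $A'_{(a)}=\{ua^{-n}\mid n\ge0,\ u\in R_e(nm)\}$ and is the integral closure of $A'_{(a)}$ in $K$. -/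

import Mathlib

open AlgebraicGeometry CategoryTheory HomogeneousLocalization
open scoped DirectSum Manifold ContDiff

universe u v

noncomputable section

namespace VertexCurve

section Scheme

instance quasiCompact_fromSpecFunctionField (X : Scheme.{u}) [IsIntegral X] :
    QuasiCompact (X.fromSpecStalk (genericPoint X)) := by
  have : Subsingleton (Spec (X.presheaf.stalk (genericPoint X))) :=
    inferInstanceAs (Subsingleton (PrimeSpectrum X.functionField))
  exact ⟨fun U _ _ => (Set.subsingleton_of_subsingleton).isCompact⟩

instance quasiSeparated_fromSpecFunctionField (X : Scheme.{u}) [IsIntegral X] :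
    QuasiSeparated (X.fromSpecStalk (genericPoint X)) := inferInstance

/-- `ν : Y ⟶ X` is the normalization of the integral scheme `X`: over `X`, it is isomorphic to the
relative normalization of `X` in the spectrum of its function field (on an affine open
`Spec B ⊆ X` this is the spectrum of the integral closure of `B` in its fraction field). -/
def IsNormalization {Y X : Scheme.{u}} (ν : Y ⟶ X) : Prop :=
  ∃ (_ : IsIntegral X) (e : Y ≅ (X.fromSpecStalk (genericPoint X)).normalization),
    e.hom ≫ (X.fromSpecStalk (genericPoint X)).fromNormalization = ν

end Scheme

section ProjMap

variable {A B σ τ : Type u} [CommRing A] [SetLike σ A] [AddSubgroupClass σ A]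
  [CommRing B] [SetLike τ B] [AddSubgroupClass τ B]
  {𝒜 : ℕ → σ} {ℬ : ℕ → τ} [GradedRing 𝒜] [GradedRing ℬ] (f : 𝒜 →+*ᵍ ℬ)

/-- The preimages of the charts `D₊(s)`, with `s` homogeneous of positive degree, cover `Proj ℬ`;
this is what is needed for `f` to induce a morphism defined on all of `Proj ℬ`. -/
def Dominates : Prop :=
  ∀ x : Proj ℬ, ∃ i, 0 < i ∧ ∃ s ∈ 𝒜 i, x ∈ Proj.basicOpen ℬ (f s)

variable {f}

/-- The cover of `Proj ℬ` by the charts `D₊(f s)`. -/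
def chartCover (h : Dominates f) : (Proj ℬ).AffineOpenCover where
  I₀ := Σ i : PNat, 𝒜 i
  X s := .of (Away ℬ (f s.2))
  f s := Proj.awayι ℬ (f s.2) (Graded.map_mem f s.2.2) s.1.pos
  idx x := ⟨⟨(h x).choose, (h x).choose_spec.1⟩,
    ⟨(h x).choose_spec.2.choose, (h x).choose_spec.2.choose_spec.1⟩⟩
  covers x := by
    exact (Proj.opensRange_awayι ℬ _ (Graded.map_mem f (h x).choose_spec.2.choose_spec.1)
      (h x).choose_spec.1).ge (h x).choose_spec.2.choose_spec.2
  map_prop s := (inferInstance :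
    IsOpenImmersion (Proj.awayι ℬ (f s.2) (Graded.map_mem f s.2.2) s.1.pos))

lemma awayMap_comp_map {d e : ℕ} {s t : A} (hs : s ∈ 𝒜 d) (ht : t ∈ 𝒜 e) (x : Away 𝒜 s) :
    awayMap ℬ (Graded.map_mem f ht) (map_mul f s t) (Away.map f s x)
      = Away.map f (s * t) (awayMap 𝒜 ht rfl x) := by
  obtain ⟨n, a, ha, rfl⟩ := x.mk_surjective _ hs
  rw [Away.map_mk, awayMap_mk, awayMap_mk, Away.map_mk]
  congr 1
  simp

/-- On `D₊(f s)` the induced morphism is `Spec` of the ring map `𝒜_(s) → ℬ_(f s)`. -/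
def chartMap (s : Σ i : PNat, 𝒜 i) : Spec (.of (Away ℬ (f s.2))) ⟶ Proj 𝒜 :=
  Spec.map (CommRingCat.ofHom (Away.map f (s.2 : A))) ≫ Proj.awayι 𝒜 (s.2 : A) s.2.2 s.1.pos

lemma chart_restrict {d e : ℕ} {s t : A} (hs : s ∈ 𝒜 d) (hd : 0 < d) (ht : t ∈ 𝒜 e) :
    Spec.map (CommRingCat.ofHom (awayMap ℬ (Graded.map_mem f ht) (map_mul f s t))) ≫
      Spec.map (CommRingCat.ofHom (Away.map f s)) ≫ Proj.awayι 𝒜 s hs hd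
    = Spec.map (CommRingCat.ofHom (Away.map f (s * t))) ≫
      Proj.awayι 𝒜 (s * t) (SetLike.mul_mem_graded hs ht) (hd.trans_le (d.le_add_right e)) := by
  have h := Proj.SpecMap_awayMap_awayι 𝒜 hs hd ht rfl
  rw [← h, ← Category.assoc, ← Category.assoc, ← Spec.map_comp, ← Spec.map_comp]
  congr 2
  ext x
  exact congrArg HomogeneousLocalization.val (awayMap_comp_map (f := f) hs ht x)

lemma chart_restrict' {d e : ℕ} {s t : A} (hs : s ∈ 𝒜 d) (hd : 0 < d) (ht : t ∈ 𝒜 e)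
    (he : 0 < e) :
    Spec.map (CommRingCat.ofHom (awayMap ℬ (Graded.map_mem f hs)
        ((map_mul f s t).trans (mul_comm _ _)))) ≫
      Spec.map (CommRingCat.ofHom (Away.map f t)) ≫ Proj.awayι 𝒜 t ht he
    = Spec.map (CommRingCat.ofHom (Away.map f (s * t))) ≫
      Proj.awayι 𝒜 (s * t) (SetLike.mul_mem_graded hs ht) (hd.trans_le (d.le_add_right e)) := by
  have h : _ = Proj.awayι 𝒜 (s * t) (SetLike.mul_mem_graded hs ht)
      (hd.trans_le (d.le_add_right e)) :=
    Proj.SpecMap_awayMap_awayι 𝒜 ht he hs (mul_comm s t)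
  rw [← h, ← Category.assoc, ← Category.assoc, ← Spec.map_comp, ← Spec.map_comp]
  congr 2
  ext x
  obtain ⟨n, a, ha, rfl⟩ := x.mk_surjective _ ht
  simp [Away.map_mk, awayMap_mk]

lemma chart_compat (s t : Σ i : PNat, 𝒜 i) :
    Limits.pullback.fst (Proj.awayι ℬ (f s.2) (Graded.map_mem f s.2.2) s.1.pos)
        (Proj.awayι ℬ (f t.2) (Graded.map_mem f t.2.2) t.1.pos) ≫ chartMap s =
      Limits.pullback.snd (Proj.awayι ℬ (f s.2) (Graded.map_mem f s.2.2) s.1.pos)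
        (Proj.awayι ℬ (f t.2) (Graded.map_mem f t.2.2) t.1.pos) ≫ chartMap t := by
  rw [← cancel_epi (Proj.pullbackAwayιIso ℬ (Graded.map_mem f s.2.2) s.1.pos
      (Graded.map_mem f t.2.2) t.1.pos (map_mul f (s.2 : A) (t.2 : A))).inv,
    Proj.pullbackAwayιIso_inv_fst_assoc, Proj.pullbackAwayιIso_inv_snd_assoc]
  exact (chart_restrict s.2.2 s.1.pos t.2.2).trans
    (chart_restrict' s.2.2 s.1.pos t.2.2 t.1.pos).symm

/-- The morphism `Proj ℬ ⟶ Proj 𝒜` induced by the graded ring homomorphism `f`, glued from the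
morphisms `Spec ℬ_(f s) ⟶ Spec 𝒜_(s)`. -/
def projMap (h : Dominates f) : Proj ℬ ⟶ Proj 𝒜 :=
  (chartCover h).openCover.glueMorphisms chartMap chart_compat

/-- The chart description that characterizes `projMap`. -/
lemma awayι_comp_projMap (h : Dominates f) {d : ℕ} {s : A} (hs : s ∈ 𝒜 d) (hd : 0 < d) :
    Proj.awayι ℬ (f s) (Graded.map_mem f hs) hd ≫ projMap h =
      Spec.map (CommRingCat.ofHom (Away.map f s)) ≫ Proj.awayι 𝒜 s hs hd :=
  (chartCover h).openCover.ι_glueMorphisms chartMap chart_compat ⟨⟨d, hd⟩, ⟨s, hs⟩⟩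

end ProjMap
section Filtered

variable {S : Type u} [CommRing S] [Algebra ℂ S]

/-- The graded ring `⨁ n, F n` of a multiplicative filtration `F` of `S`. -/
def Blowup (F : ℕ → Submodule ℂ S) : Type u := ⨁ n, F n

section

variable (F : ℕ → Submodule ℂ S) [SetLike.GradedMonoid F]

instance : CommRing (Blowup F) := inferInstanceAs (CommRing (⨁ n, F n))

instance : Algebra ℂ (Blowup F) := inferInstanceAs (Algebra ℂ (⨁ n, F n))

/-- The element `u ∈ F n`, placed in degree `n`. -/
def homog (n : ℕ) : F n →ₗ[ℂ] Blowup F := DirectSum.lof ℂ ℕ (fun n => F n) n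

/-- The homogeneous component of degree `n` of `⨁ n, F n`. -/
def piece (n : ℕ) : Submodule ℂ (Blowup F) := LinearMap.range (homog F n)

variable {F} in
lemma homog_mul {m n : ℕ} (u : F m) (v : F n) :
    homog F m u * homog F n v = homog F (m + n) ⟨u * v, SetLike.mul_mem_graded u.2 v.2⟩ :=
  DirectSum.of_mul_of (A := fun n => F n) u v

lemma homog_one : homog F 0 ⟨1, SetLike.one_mem_graded F⟩ = 1 := rfl

variable {F} in
lemma linearMap_ext {V : Type*} [AddCommMonoid V] [Module ℂ V] {f g : Blowup F →ₗ[ℂ] V}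
    (h : ∀ n u, f (homog F n u) = g (homog F n u)) : f = g :=
  DirectSum.linearMap_ext (M := fun n => F n) ℂ fun n => LinearMap.ext fun u => h n u

/-- The linear map out of `⨁ n, F n` with given components. -/
def lift {V : Type*} [AddCommMonoid V] [Module ℂ V] (φ : ∀ n, F n →ₗ[ℂ] V) :
    Blowup F →ₗ[ℂ] V := DirectSum.toModule ℂ ℕ V φ

variable {F} in
lemma lift_homog {V : Type*} [AddCommMonoid V] [Module ℂ V] (φ : ∀ n, F n →ₗ[ℂ] V) (n : ℕ)
    (u : F n) : lift F φ (homog F n u) = φ n u :=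
  DirectSum.toModule_lof (M := fun n => F n) ℂ n u

instance : SetLike.GradedMonoid (piece F) where
  one_mem := ⟨_, homog_one F⟩
  mul_mem := by
    rintro i j _ _ ⟨x, rfl⟩ ⟨y, rfl⟩
    exact ⟨_, (homog_mul x y).symm⟩

instance : DirectSum.Decomposition (piece F) :=
  DirectSum.Decomposition.ofLinearMap (piece F)
    (lift F fun n => (DirectSum.lof ℂ ℕ (fun n => piece F n) n).comp (homog F n).rangeRestrict)
    (by
      refine linearMap_ext fun n u => ?_
      rw [LinearMap.comp_apply, lift_homog]
      exact DirectSum.coeLinearMap_lof (piece F) n _)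
    (by
      refine DirectSum.linearMap_ext _ fun n => LinearMap.ext fun x => ?_
      obtain ⟨_, y, rfl⟩ := x
      rw [LinearMap.comp_apply, LinearMap.comp_apply, DirectSum.coeLinearMap_lof, lift_homog]
      rfl)

instance : GradedAlgebra (piece F) where

end

variable {F G : ℕ → Submodule ℂ S} [SetLike.GradedMonoid F] [SetLike.GradedMonoid G]

/-- The inclusion `⨁ n, F n ⊆ ⨁ n, G n` of graded rings, for filtrations with `F n ≤ G n`. -/
def blowupIncl (h : ∀ n, F n ≤ G n) : piece F →+*ᵍ piece G where
  toRingHom := DirectSum.toSemiring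
    (fun n => ((homog G n).comp (Submodule.inclusion (h n))).toAddMonoidHom)
    rfl (fun x y => (homog_mul (Submodule.inclusion (h _) x) (Submodule.inclusion (h _) y)).symm)
  map_mem := by
    rintro i _ ⟨x, rfl⟩
    refine ⟨Submodule.inclusion (h i) x, ?_⟩
    exact (DirectSum.toAddMonoid_of (β := fun n => F n) (fun n =>
      ((homog G n).comp (Submodule.inclusion (h n))).toAddMonoidHom) i x).symm

lemma blowupIncl_homog (h : ∀ n, F n ≤ G n) (n : ℕ) (u : F n) :
    blowupIncl h (homog F n u) = homog G n (Submodule.inclusion (h n) u) :=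
  DirectSum.toAddMonoid_of (β := fun n => F n) (fun n =>
    ((homog G n).comp (Submodule.inclusion (h n))).toAddMonoidHom) n u

lemma homog_congr {m n : ℕ} {u : G m} {v : G n} (h : m = n) (h' : (u : S) = v) :
    homog G m u = homog G n v := by
  subst h
  rw [Subtype.ext h']

lemma prod_mem_filtration {κ : Type} (K : Finset κ) {n : ℕ} {w : κ → S} (hw : ∀ k, w k ∈ G n) :
    ∏ k ∈ K, w k ∈ G (n * K.card) := by
  classical
  induction K using Finset.induction_on with
  | empty => simpa using SetLike.one_mem_graded G
  | insert k K hk ih =>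
    rw [Finset.prod_insert hk, Finset.card_insert_of_notMem hk, mul_add, mul_one, add_comm]
    exact SetLike.mul_mem_graded (hw k) ih

lemma prod_homog {κ : Type} (K : Finset κ) {n : ℕ} {w : κ → S} (hw : ∀ k, w k ∈ G n) :
    ∏ k ∈ K, homog G n ⟨w k, hw k⟩ =
      homog G (n * K.card) ⟨∏ k ∈ K, w k, prod_mem_filtration K hw⟩ := by
  classical
  induction K using Finset.induction_on with
  | empty => exact (homog_one G).symm.trans (homog_congr (by simp) (by simp))
  | insert k K hk ih =>
    rw [Finset.prod_insert hk, ih, homog_mul]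
    exact homog_congr (by rw [Finset.card_insert_of_notMem hk]; ring)
      (Finset.prod_insert hk).symm

lemma one_mem_filtration (h1 : ∀ n, G n ≤ G (n + 1)) (n : ℕ) : (1 : S) ∈ G n := by
  induction n with
  | zero => exact SetLike.one_mem_graded G
  | succ n ih => exact h1 n ih

lemma sub_algebraMap_mem (h1 : ∀ n, G n ≤ G (n + 1)) {n : ℕ} {u : S} (hu : u ∈ G n) (c : ℂ) :
    u - algebraMap ℂ S c ∈ G n := by
  rw [Algebra.algebraMap_eq_smul_one]
  exact sub_mem hu (Submodule.smul_mem _ c (one_mem_filtration h1 n))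

lemma dominates_of_prod_mem (h : ∀ n, F n ≤ G n) (hF : ∀ n, F n ≤ F (n + 1))
    (hG : ∀ n, G n ≤ G (n + 1)) {κ : Type} [Fintype κ] (c : S → κ → ℂ)
    (hc : ∀ n, ∀ u ∈ G n,
      u * ∏ k, (u - algebraMap ℂ S (c u k)) ∈ F (n + n * (Finset.univ : Finset κ).card)) :
    Dominates (blowupIncl h) := by
  classical
  intro x
  by_contra! hx
  have himage : ∀ n (_ : 0 < n) (u : F n),
      homog G n (Submodule.inclusion (h n) u) ∈ x.asHomogeneousIdeal.toIdeal := by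
    intro n hn u
    have h1 := hx n hn (homog F n u) ⟨u, rfl⟩
    rw [Proj.mem_basicOpen, not_not, blowupIncl_homog] at h1
    exact h1
  have hpos : ∀ n (_ : 0 < n) (u : G n), homog G n u ∈ x.asHomogeneousIdeal.toIdeal := by
    rintro n hn ⟨u, hu⟩
    have hw : ∀ k, u - algebraMap ℂ S (c u k) ∈ G n := fun k => sub_algebraMap_mem hG hu _
    have h1 := himage _ (by omega) ⟨_, hc n u hu⟩
    have h2 : homog G n ⟨u, hu⟩ * ∏ k, homog G n ⟨_, hw k⟩ ∈ x.asHomogeneousIdeal.toIdeal := by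
      rw [prod_homog, homog_mul]
      exact h1
    have hp := x.isPrime
    rcases Ideal.IsPrime.mem_or_mem hp h2 with h3 | h3
    · exact h3
    · obtain ⟨k, -, hk⟩ := (Ideal.IsPrime.prod_mem_iff (hp := hp)).1 h3
      have h4 := Ideal.mul_mem_left _ (algebraMap ℂ (Blowup G) (c u k))
        (himage n hn ⟨1, one_mem_filtration hF n⟩)
      have h5 := Ideal.add_mem _ hk h4
      rw [← Algebra.smul_def, ← map_smul, ← map_add] at h5
      convert h5 using 2
      ext
      simp [Algebra.algebraMap_eq_smul_one]
  refine x.not_irrelevant_le fun y hy => ?_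
  change y ∈ x.asHomogeneousIdeal.toIdeal
  rw [← DirectSum.sum_support_decompose (piece G) y]
  refine Ideal.sum_mem _ fun n _ => ?_
  rcases Nat.eq_zero_or_pos n with rfl | hn
  · have : ((DirectSum.decompose (piece G) y 0 : piece G 0) : Blowup G) = 0 := hy
    rw [this]
    exact Ideal.zero_mem _
  · obtain ⟨u, hu⟩ := (DirectSum.decompose (piece G) y n).2
    rw [← hu]
    exact hpos n hn u

end Filtered

section Surface
variable {X : Type u} [TopologicalSpace X] [T2Space X]

/-- The punctured surface `X ∖ {pInf}`. -/
def puncture (pInf : X) : TopologicalSpace.Opens X := ⟨{pInf}ᶜ, isOpen_compl_singleton⟩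

variable [ChartedSpace ℂ X]

/-- A holomorphic local coordinate around `pInf`, vanishing at `pInf`. -/
structure LocalCoordinate (pInf : X) where
  chart : OpenPartialHomeomorph X ℂ
  mem_atlas : chart ∈ IsManifold.maximalAtlas 𝓘(ℂ) ω X
  mem_source : pInf ∈ chart.source
  map_base : chart pInf = 0

variable {pInf : X} (z : LocalCoordinate pInf)

/-- The function `f` written in the coordinate `z` (with irrelevant value `0` at `pInf` itself). -/
def expand (f : puncture pInf → ℂ) : ℂ → ℂ :=
  Function.extend Subtype.val f 0 ∘ z.chart.symm

lemma expand_add (f g : puncture pInf → ℂ) : expand z (f + g) = expand z f + expand z g := by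
  have := Function.extend_add (Subtype.val : puncture pInf → X) f g 0 0
  simp only [add_zero] at this
  unfold expand
  rw [this]
  rfl

lemma expand_mul (f g : puncture pInf → ℂ) : expand z (f * g) = expand z f * expand z g := by
  have := Function.extend_mul (Subtype.val : puncture pInf → X) f g 0 0
  simp only [mul_zero] at this
  unfold expand
  rw [this]
  rfl

lemma eventually_symm_ne : ∀ᶠ w in nhdsWithin (0 : ℂ) {0}ᶜ, z.chart.symm w ≠ pInf := by
  have h0 : (0 : ℂ) ∈ z.chart.target := z.map_base ▸ z.chart.map_source z.mem_source
  filter_upwards [nhdsWithin_le_nhds (z.chart.open_target.mem_nhds h0), self_mem_nhdsWithin]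
    with w hw hw0 h
  apply hw0
  rw [Set.mem_singleton_iff, ← z.chart.right_inv hw, h, z.map_base]

lemma expand_const (c : ℂ) :
    expand z (fun _ => c) =ᶠ[nhdsWithin (0 : ℂ) {0}ᶜ] fun _ => c := by
  filter_upwards [eventually_symm_ne z] with w hw
  exact Subtype.val_injective.extend_apply (fun _ : puncture pInf => c) 0 ⟨_, hw⟩

lemma meromorphicAt_expand_const (c : ℂ) : MeromorphicAt (expand z fun _ => c) 0 :=
  (MeromorphicAt.const c 0).congr (expand_const z c).symm

lemma order_expand_const (c : ℂ) :
    0 ≤ meromorphicOrderAt (expand z fun _ => c) 0 := by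
  classical
  rw [meromorphicOrderAt_congr (expand_const z c), meromorphicOrderAt_const]
  split_ifs <;> simp

/-- `R = H⁰(X, 𝒪(∗pInf))`: the functions which are holomorphic on `X ∖ {pInf}` and meromorphic at
`pInf`. -/
def functionRing : Subalgebra ℂ (puncture pInf → ℂ) where
  carrier := {f | MDifferentiable 𝓘(ℂ) 𝓘(ℂ) f ∧ MeromorphicAt (expand z f) 0}
  mul_mem' := fun hf hg => ⟨hf.1.mul hg.1, expand_mul z _ _ ▸ hf.2.mul hg.2⟩
  add_mem' := fun hf hg => ⟨hf.1.add hg.1, expand_add z _ _ ▸ hf.2.add hg.2⟩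
  algebraMap_mem' c := ⟨mdifferentiable_const, meromorphicAt_expand_const z c⟩

/-- `R(n) = H⁰(X, 𝒪(n pInf))`: the elements of `R` with a pole of order at most `n` at `pInf`. -/
def poleFiltration (n : ℕ) : Submodule ℂ (puncture pInf → ℂ) where
  carrier := {f | f ∈ functionRing z ∧ (-(n : ℤ) : ℤ) ≤ meromorphicOrderAt (expand z f) 0}
  zero_mem' := ⟨zero_mem _, le_trans (WithTop.coe_le_coe.2 (by omega)) (order_expand_const z 0)⟩
  add_mem' := fun hf hg => ⟨add_mem hf.1 hg.1, by
    rw [expand_add]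
    exact (le_min hf.2 hg.2).trans (meromorphicOrderAt_add hf.1.2 hg.1.2)⟩
  smul_mem' c f hf := by
    refine ⟨Subalgebra.smul_mem _ hf.1 c, ?_⟩
    have h : c • f = (fun _ => c) * f := rfl
    rw [h, expand_mul, meromorphicOrderAt_mul (meromorphicAt_expand_const z c) hf.1.2]
    simpa using add_le_add (order_expand_const z c) hf.2

instance : SetLike.GradedMonoid (poleFiltration z) where
  one_mem := ⟨one_mem _, le_trans (WithTop.coe_le_coe.2 (by simp)) (order_expand_const z 1)⟩
  mul_mem := by
    rintro i j f g hf hg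
    refine ⟨mul_mem hf.1 hg.1, ?_⟩
    rw [expand_mul, meromorphicOrderAt_mul hf.1.2 hg.1.2]
    refine le_trans ?_ (add_le_add hf.2 hg.2)
    rw [← WithTop.coe_add]
    exact WithTop.coe_le_coe.2 (by push_cast; omega)

variable (E : X → Type v) [∀ x, AddCommGroup (E x)] [∀ x, Module ℂ (E x)]
  [∀ x, TopologicalSpace (E x)] [TopologicalSpace (Bundle.TotalSpace ℂ E)]
  [FiberBundle ℂ E] [VectorBundle ℂ ℂ E]

/-- The coefficient function of the section `s` in a trivialization of the line bundle around
`pInf` (it is `0` where the trivialization is not defined). -/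
def coeffAtInfinity (s : ∀ x : puncture pInf, E x) (x : puncture pInf) : ℂ :=
  (trivializationAt ℂ E pInf).linearMapAt ℂ (x : X) (s x)

/-- `s` is a holomorphic section over `X ∖ {pInf}`. -/
def IsHolomorphicSection (s : ∀ x : puncture pInf, E x) : Prop :=
  MDifferentiable 𝓘(ℂ) (𝓘(ℂ).prod 𝓘(ℂ))
    fun x : puncture pInf => (⟨(x : X), s x⟩ : Bundle.TotalSpace ℂ E)

variable {E}
lemma isHolomorphicSection_iff [IsManifold 𝓘(ℂ) ω X] (s : ∀ x : puncture pInf, E x) :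
    IsHolomorphicSection E s ↔ ∀ x₀ : puncture pInf,
      MDifferentiableAt 𝓘(ℂ) 𝓘(ℂ) (fun x : puncture pInf =>
        (trivializationAt ℂ E (x₀ : X)).linearMapAt ℂ (x : X) (s x)) x₀ := by
  refine forall_congr' fun x₀ => ?_
  rw [mdifferentiableAt_totalSpace]
  have hval : MDifferentiableAt 𝓘(ℂ) 𝓘(ℂ) (fun x : puncture pInf => (x : X)) x₀ :=
    (contMDiff_subtype_val (n := ω)).mdifferentiable (by simp) x₀
  rw [and_iff_right hval]
  refine Filter.EventuallyEq.mdifferentiableAt_iff ?_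
  have hopen : (Subtype.val : puncture pInf → X) ⁻¹'
      (trivializationAt ℂ E (x₀ : X)).baseSet ∈ nhds x₀ :=
    continuous_subtype_val.continuousAt.preimage_mem_nhds
      ((trivializationAt ℂ E (x₀ : X)).open_baseSet.mem_nhds
        (FiberBundle.mem_baseSet_trivializationAt' _))
  filter_upwards [hopen] with x hx
  exact (congrFun (Bundle.Trivialization.coe_linearMapAt_of_mem _ hx) _).symm

variable (E)

/-- `H⁰(X, E(∗pInf))`: the sections of the line bundle `E` which are holomorphic on `X ∖ {pInf}` and
meromorphic at `pInf`. -/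
def sections [IsManifold 𝓘(ℂ) ω X] : Submodule ℂ (∀ x : puncture pInf, E x) where
  carrier := {s | IsHolomorphicSection E s ∧ MeromorphicAt (expand z (coeffAtInfinity E s)) 0}
  zero_mem' := by
    refine ⟨(isHolomorphicSection_iff _).2 fun x₀ => ?_, ?_⟩
    · simpa using mdifferentiableAt_const
    · have : coeffAtInfinity E (0 : ∀ x : puncture pInf, E x) = fun _ => 0 := by
        funext x; simp [coeffAtInfinity]
      rw [this]
      exact meromorphicAt_expand_const z 0
  add_mem' := by
    rintro s t ⟨hs, hs'⟩ ⟨ht, ht'⟩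
    rw [isHolomorphicSection_iff] at hs ht
    refine ⟨(isHolomorphicSection_iff _).2 fun x₀ => ?_, ?_⟩
    · simpa using! (hs x₀).add (ht x₀)
    · have : coeffAtInfinity E (s + t) = coeffAtInfinity E s + coeffAtInfinity E t := by
        funext x; simp [coeffAtInfinity]
      rw [this, expand_add]
      exact hs'.add ht'
  smul_mem' := by
    rintro c s ⟨hs, hs'⟩
    rw [isHolomorphicSection_iff] at hs
    refine ⟨(isHolomorphicSection_iff _).2 fun x₀ => ?_, ?_⟩
    · simpa using! (hs x₀).const_smul c
    · have : coeffAtInfinity E (c • s) = (fun _ => c) * coeffAtInfinity E s := by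
        funext x; simp [coeffAtInfinity]
      rw [this, expand_mul]
      exact (meromorphicAt_expand_const z c).mul hs'

variable {E z} in
lemma smul_mem_sections [IsManifold 𝓘(ℂ) ω X] {f : puncture pInf → ℂ} (hf : f ∈ functionRing z)
    {s : ∀ x : puncture pInf, E x} (hs : s ∈ sections z E) :
    (fun x => f x • s x) ∈ sections z E := by
  obtain ⟨hs, hs'⟩ := hs
  rw [isHolomorphicSection_iff] at hs
  refine ⟨(isHolomorphicSection_iff _).2 fun x₀ => ?_, ?_⟩
  · simpa using! (hf.1 x₀).mul (hs x₀)
  · have : coeffAtInfinity E (fun x => f x • s x) = f * coeffAtInfinity E s := by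
      funext x; simp [coeffAtInfinity]
    rw [this, expand_mul]
    exact hf.2.mul hs'


/-- The data of the vertex operator: distinct points `P i`, `Q j` in the coordinate neighbourhood,
different from `pInf`, an `M × N` matrix `a`, and for each of the points a frame of the fibre of the
line bundle there, with respect to which values of sections are taken. -/
structure VertexData (N M : ℕ) where
  P : Fin N → puncture pInf
  Q : Fin M → puncture pInf
  P_mem : ∀ i, (P i : X) ∈ z.chart.source
  Q_mem : ∀ j, (Q j : X) ∈ z.chart.source
  distinct : Function.Injective (Sum.elim P Q)
  a : Matrix (Fin M) (Fin N) ℂ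
  frameP : ∀ i, E (P i) ≃ₗ[ℂ] ℂ
  frameQ : ∀ j, E (Q j) ≃ₗ[ℂ] ℂ

namespace VertexData

variable {z E} {N M : ℕ} (D : VertexData z E N M)

/-- The coordinate `p_i` of `P i`. -/
def p (i : Fin N) : ℂ := z.chart (D.P i)

/-- The coordinate `q_j` of `Q j`. -/
def q (j : Fin M) : ℂ := z.chart (D.Q j)

/-- `b j i` is the coefficient `b_{N+j,i} = a_{j,i} ∏_{m ≠ i} (p_i⁻¹ - p_m⁻¹) / (q_j⁻¹ - p_m⁻¹)`. -/
def b (j : Fin M) (i : Fin N) : ℂ :=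
  D.a j i * ∏ m ∈ Finset.univ.erase i,
    (((D.p i)⁻¹ - (D.p m)⁻¹) / ((D.q j)⁻¹ - (D.p m)⁻¹))

/-- The coefficient `b_{N+j,i} p_i⁻¹ q_j`. -/
def b' (j : Fin M) (i : Fin N) : ℂ := D.b j i * ((D.p i)⁻¹ * D.q j)

variable [IsManifold 𝓘(ℂ) ω X]

/-- The space `W_e` of the sections `f` with `f(p_i) = - ∑_j b_{N+j,i} p_i⁻¹ q_j f(q_j)`. -/
def W : Submodule ℂ (∀ x : puncture pInf, E x) where
  carrier := {s | s ∈ sections z E ∧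
    ∀ i, D.frameP i (s (D.P i)) = -∑ j, D.b' j i * D.frameQ j (s (D.Q j))}
  zero_mem' := ⟨zero_mem _, fun i => by simp⟩
  add_mem' := fun hs ht => ⟨add_mem hs.1 ht.1, fun i => by
    simp only [Pi.add_apply, map_add, hs.2 i, ht.2 i, mul_add, Finset.sum_add_distrib]
    ring⟩
  smul_mem' c s hs := ⟨Submodule.smul_mem _ c hs.1, fun i => by
    simp only [Pi.smul_apply, map_smul, hs.2 i, smul_eq_mul, mul_neg, Finset.mul_sum,
      mul_left_comm]⟩

/-- The stabilizer `R_e` of `W_e` in `R`. -/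
def Re : Subalgebra ℂ (puncture pInf → ℂ) where
  carrier := {f | f ∈ functionRing z ∧ ∀ s ∈ D.W, (fun x => f x • s x) ∈ D.W}
  mul_mem' := fun hf hg => ⟨mul_mem hf.1 hg.1, fun s hs => by
    simpa [mul_smul] using hf.2 _ (hg.2 s hs)⟩
  add_mem' := fun hf hg => ⟨add_mem hf.1 hg.1, fun s hs => by
    simpa [add_smul] using! add_mem (hf.2 s hs) (hg.2 s hs)⟩
  algebraMap_mem' c := ⟨algebraMap_mem _ c, fun s hs => D.W.smul_mem c hs⟩

lemma Re_le : D.Re ≤ functionRing z := fun _ hf => hf.1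

/-- `R_e(n) = R(n) ∩ R_e`. -/
def ReFiltration (n : ℕ) : Submodule ℂ (puncture pInf → ℂ) :=
  poleFiltration z n ⊓ Subalgebra.toSubmodule D.Re

lemma ReFiltration_le (n : ℕ) : D.ReFiltration n ≤ poleFiltration z n := inf_le_left

instance : SetLike.GradedMonoid D.ReFiltration where
  one_mem := ⟨SetLike.one_mem_graded (poleFiltration z), one_mem D.Re⟩
  mul_mem _ _ _ _ hf hg :=
    ⟨SetLike.mul_mem_graded hf.1 hg.1, mul_mem (S := Subalgebra ℂ _) hf.2 hg.2⟩

lemma mem_Re_of_vanish {f : puncture pInf → ℂ} (hf : f ∈ functionRing z)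
    (hP : ∀ i, f (D.P i) = 0) (hQ : ∀ j, f (D.Q j) = 0) : f ∈ D.Re :=
  ⟨hf, fun s hs => ⟨smul_mem_sections hf hs.1, fun i => by simp [hP, hQ]⟩⟩

lemma dominates : Dominates (blowupIncl D.ReFiltration_le) := by
  have hmono : ∀ n, poleFiltration z n ≤ poleFiltration z (n + 1) := fun n f hf =>
    ⟨hf.1, le_trans (WithTop.coe_le_coe.2 (by push_cast; omega)) hf.2⟩
  refine dominates_of_prod_mem _ (fun n f hf => ⟨hmono n hf.1, hf.2⟩) hmono
    (fun u k => u (Sum.elim D.P D.Q k)) fun n u hu => ?_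
  have hmem := SetLike.mul_mem_graded hu (prod_mem_filtration Finset.univ
    (fun k => sub_algebraMap_mem hmono hu (u (Sum.elim D.P D.Q k))))
  refine ⟨hmem, D.mem_Re_of_vanish hmem.1 (fun i => ?_) fun j => ?_⟩
  · have h0 : ∏ k, (u (D.P i) - u (Sum.elim D.P D.Q k)) = 0 :=
      Finset.prod_eq_zero (Finset.mem_univ (Sum.inl i)) (sub_self _)
    rw [Pi.mul_apply, Finset.prod_apply]
    exact mul_eq_zero_of_right _ h0
  · have h0 : ∏ k, (u (D.Q j) - u (Sum.elim D.P D.Q k)) = 0 :=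
      Finset.prod_eq_zero (Finset.mem_univ (Sum.inr j)) (sub_self _)
    rw [Pi.mul_apply, Finset.prod_apply]
    exact mul_eq_zero_of_right _ h0

end VertexData

/-- The projective curve `C = Proj (⨁ n, R(n))` of the Riemann surface. -/
def curve : Scheme.{u} := Proj (piece (poleFiltration z))

namespace VertexData

variable {z E} {N M : ℕ} [IsManifold 𝓘(ℂ) ω X] (D : VertexData z E N M)

/-- The curve `C' = Proj (⨁ n, R_e(n))`. -/
def curve' : Scheme.{u} := Proj (piece D.ReFiltration)

/-- The morphism `C ⟶ C'` induced by the inclusion `⨁ n, R_e(n) ⊆ ⨁ n, R(n)`. -/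
def ψ : curve z ⟶ D.curve' := projMap D.dominates

end VertexData

/-- The quotient field `K` of `R`. -/
abbrev functionField : Type u := FractionRing (functionRing z)

variable {z} in
/-- For `a ∈ F m`, the ring of the elements `u a⁻ⁿ` of `K` with `n ≥ 0` and `u ∈ F (n m)`. -/
def chartRing (F : ℕ → Submodule ℂ (puncture pInf → ℂ)) [SetLike.GradedMonoid F]
    {m : ℕ} {a : functionRing z} (ha : (a : puncture pInf → ℂ) ∈ F m) :
    Subalgebra ℂ (functionField z) where
  carrier := {x | ∃ n, ∃ u : functionRing z, (u : puncture pInf → ℂ) ∈ F (n * m) ∧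
    x * algebraMap (functionRing z) (functionField z) a ^ n =
      algebraMap (functionRing z) (functionField z) u}
  mul_mem' := by
    rintro x y ⟨n, u, hu, hx⟩ ⟨k, v, hv, hy⟩
    refine ⟨n + k, u * v, ?_, ?_⟩
    · rw [add_mul]
      exact SetLike.mul_mem_graded hu hv
    · rw [map_mul, ← hx, ← hy, pow_add]
      exact mul_mul_mul_comm _ _ _ _
  add_mem' := by
    rintro x y ⟨n, u, hu, hx⟩ ⟨k, v, hv, hy⟩
    refine ⟨n + k, u * a ^ k + v * a ^ n, ?_, ?_⟩
    · refine add_mem ?_ ?_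
      · rw [add_mul]
        exact SetLike.mul_mem_graded hu (SetLike.pow_mem_graded k ha)
      · rw [add_mul, add_comm (n * m)]
        exact SetLike.mul_mem_graded hv (SetLike.pow_mem_graded n ha)
    · rw [map_add, map_mul, map_mul, map_pow, map_pow, ← hx, ← hy, pow_add, add_mul, mul_assoc,
        mul_assoc y, mul_comm (_ ^ k) (_ ^ n)]
  algebraMap_mem' c := by
    refine ⟨0, algebraMap ℂ _ c, ?_, ?_⟩
    · rw [zero_mul]
      have h : ((algebraMap ℂ (functionRing z) c : functionRing z) : puncture pInf → ℂ) = c • 1 :=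
        Algebra.algebraMap_eq_smul_one (A := puncture pInf → ℂ) c
      rw [h]
      exact Submodule.smul_mem _ c (SetLike.one_mem_graded F)
    · rw [pow_zero, mul_one, ← IsScalarTower.algebraMap_apply]

variable {z} in
lemma chartRing_mono {F G : ℕ → Submodule ℂ (puncture pInf → ℂ)} [SetLike.GradedMonoid F]
    [SetLike.GradedMonoid G] (h : ∀ n, F n ≤ G n) {m : ℕ} {a : functionRing z}
    (ha : (a : puncture pInf → ℂ) ∈ F m) : chartRing F ha ≤ chartRing G (h m ha) := by
  rintro x ⟨n, u, hu, hx⟩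
  exact ⟨n, u, h _ hu, hx⟩

end Surface

end VertexCurve

end

noncomputable section

set_option linter.unusedSectionVars false

namespace VertexCurve

/-! ### Punctured neighbourhoods read in charts. -/

section Punctured

open Filter Topology

variable {X Y : Type*} [TopologicalSpace X] [TopologicalSpace Y]
  (e : OpenPartialHomeomorph X Y) {x : X}

/-! Two facts carry the theorem: `R_e` is large in `R`, and `R` and its projective charts are
integrally closed.

A function in `R` that vanishes at all the points `P_i`, `Q_j` multiplies every section to one whose
values there are zero, so it lies in `R_e`. Hence `R / R_e` embeds into a quotient of the space of
values at `N + M` points, and `R` is finite over `R_e` (`finite_inclusion_of_functionals`,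
`VertexData.finite_inclusion_Re`). After passing to a common denominator the same count applies to
`A_(a)` over `A'_(a)` (`VertexData.finite_inclusion_chartRing`). The quotient field of `R_e` is `K`:
a nonzero function vanishing at all the points can be cancelled from a fraction, and if there is
none then `R` is just `ℂ` (`VertexData.exists_mul_eq_of_Re`).

The order of vanishing at a point is a valuation of `K`, and elements integral over a ring of
nonnegative elements are nonnegative. If `f/g` is integral over `R`, then it has nonnegative order
at each point other than `pInf`, so its singularities there are removable and it lies in `R`
(`exists_mul_eq_of_pointOrder_le`). An element integral over `A_(a)` lies in `R[1/a]`, which is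
again integrally closed. If `a` has exact pole order `m`, the valuation at `pInf` bounds the pole of
the numerator; if the pole is smaller, the chart is all of `R[1/a]`
(`mem_chartRing_of_isIntegralElem`).

For the schemes, `ψ` restricts over each chart of `C'` to `Spec` of `A'_(a) → A_(a)`, so it is
finite. The generic point of `C'` factors through `ψ`, which gives an integral comparison map from
the normalization to `C`; this map is an isomorphism because the charts of `C` are integrally closed
in `K` (`isNormalization_projMap`). -/

lemma tendsto_chart_punctured (hx : x ∈ e.source) : Tendsto e (𝓝[≠] x) (𝓝[≠] (e x)) := by
  refine tendsto_nhdsWithin_iff.2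
    ⟨(e.continuousAt hx).tendsto.mono_left nhdsWithin_le_nhds, ?_⟩
  filter_upwards [nhdsWithin_le_nhds (e.open_source.mem_nhds hx), self_mem_nhdsWithin]
    with y hy hne h
  exact hne (e.injOn hy hx h)

lemma tendsto_chart_symm_punctured (hx : x ∈ e.source) :
    Tendsto e.symm (𝓝[≠] (e x)) (𝓝[≠] x) := by
  have h := tendsto_chart_punctured e.symm (e.map_source hx)
  rwa [e.left_inv hx] at h

lemma eventually_punctured_chart_iff (hx : x ∈ e.source) {p : X → Prop} :
    (∀ᶠ w in 𝓝[≠] (e x), p (e.symm w)) ↔ ∀ᶠ y in 𝓝[≠] x, p y := by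
  refine ⟨fun h => ?_, fun h => (tendsto_chart_symm_punctured e hx).eventually h⟩
  filter_upwards [(tendsto_chart_punctured e hx).eventually h,
    nhdsWithin_le_nhds (e.open_source.mem_nhds hx)] with y hy hys
  rwa [e.left_inv hys] at hy

lemma neBot_punctured [ChartedSpace ℂ X] (x : X) : (𝓝[≠] x).NeBot :=
  (tendsto_chart_symm_punctured (chartAt ℂ x) (mem_chart_source ℂ x)).neBot

end Punctured

/-! ### Orders of vanishing on the surface, the identity theorem and removable singularities. -/

section Surface

variable {X : Type u} [TopologicalSpace X] [T2Space X] {pInf : X}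

/-- The extension by `0` to the whole surface. -/
def extendZero (f : puncture pInf → ℂ) : X → ℂ := Function.extend Subtype.val f 0

lemma extendZero_coe (f : puncture pInf → ℂ) (x : puncture pInf) : extendZero f x = f x :=
  Subtype.val_injective.extend_apply _ _ _

lemma extendZero_of_ne (f : puncture pInf → ℂ) {x : X} (hx : x ≠ pInf) :
    extendZero f x = f ⟨x, hx⟩ := extendZero_coe f ⟨x, hx⟩

lemma extendZero_add (f g : puncture pInf → ℂ) :
    extendZero (f + g) = extendZero f + extendZero g := by
  have := Function.extend_add (Subtype.val : puncture pInf → X) f g 0 0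
  rwa [add_zero] at this

lemma extendZero_mul (f g : puncture pInf → ℂ) :
    extendZero (f * g) = extendZero f * extendZero g := by
  have := Function.extend_mul (Subtype.val : puncture pInf → X) f g 0 0
  rwa [mul_zero] at this

variable [ChartedSpace ℂ X]

open Topology in
lemma eventually_ne_base (x : X) : ∀ᶠ y in 𝓝[≠] x, y ≠ pInf := by
  rcases eq_or_ne x pInf with rfl | hx
  · exact self_mem_nhdsWithin
  · exact nhdsWithin_le_nhds (isOpen_compl_singleton.mem_nhds hx)

variable [IsManifold 𝓘(ℂ) ω X]

lemma mdifferentiableAt_extendZero {f : puncture pInf → ℂ} {x : puncture pInf} :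
    MDifferentiableAt 𝓘(ℂ) 𝓘(ℂ) (extendZero f) (x : X) ↔ MDifferentiableAt 𝓘(ℂ) 𝓘(ℂ) f x := by
  have h : extendZero f ∘ Subtype.val = f := funext (extendZero_coe f)
  have := (differentiableWithinAt_localInvariantProp (I := 𝓘(ℂ))
    (I' := 𝓘(ℂ))).liftPropAt_iff_comp_subtype_val (extendZero f) x
  rw [h] at this
  exact this

lemma differentiableAt_extendZero_comp_symm {f : puncture pInf → ℂ}
    (hf : MDifferentiable 𝓘(ℂ) 𝓘(ℂ) f) {e : OpenPartialHomeomorph X ℂ}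
    (he : e ∈ IsManifold.maximalAtlas 𝓘(ℂ) ω X) {w : ℂ} (hw : w ∈ e.target)
    (hne : e.symm w ≠ pInf) : DifferentiableAt ℂ (extendZero f ∘ e.symm) w := by
  rw [← mdifferentiableAt_iff_differentiableAt]
  refine MDifferentiableAt.comp w (mdifferentiableAt_extendZero.2 (hf ⟨_, hne⟩)) ?_
  exact ((contMDiffOn_symm_of_mem_maximalAtlas he).contMDiffAt
    (e.open_target.mem_nhds hw)).mdifferentiableAt (by simp)

lemma analyticAt_extendZero_comp_symm {f : puncture pInf → ℂ}
    (hf : MDifferentiable 𝓘(ℂ) 𝓘(ℂ) f) {e : OpenPartialHomeomorph X ℂ}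
    (he : e ∈ IsManifold.maximalAtlas 𝓘(ℂ) ω X) {x : X} (hx : x ∈ e.source)
    (hne : x ≠ pInf) : AnalyticAt ℂ (extendZero f ∘ e.symm) (e x) := by
  have hcont : ContinuousAt e.symm (e x) := e.continuousAt_symm (e.map_source hx)
  have hU : e.target ∩ e.symm ⁻¹' {pInf}ᶜ ∈ nhds (e x) :=
    Filter.inter_mem (e.open_target.mem_nhds (e.map_source hx))
      (hcont.preimage_mem_nhds (isOpen_compl_singleton.mem_nhds (by rwa [e.left_inv hx])))
  exact DifferentiableOn.analyticAt (fun w hw =>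
    (differentiableAt_extendZero_comp_symm hf he hw.1 hw.2).differentiableWithinAt) hU

variable (z : LocalCoordinate pInf)

open Classical in
/-- A chart around `x`, which is the given coordinate at `pInf`. -/
def localChart (x : X) : OpenPartialHomeomorph X ℂ :=
  if x = pInf then z.chart else chartAt ℂ x

lemma localChart_base : localChart z pInf = z.chart := if_pos rfl

lemma mem_localChart_source (x : X) : x ∈ (localChart z x).source := by
  unfold localChart
  split_ifs with h
  · exact h ▸ z.mem_source
  · exact mem_chart_source ℂ x

lemma localChart_mem_maximalAtlas (x : X) :
    localChart z x ∈ IsManifold.maximalAtlas 𝓘(ℂ) ω X := by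
  unfold localChart
  split_ifs
  · exact z.mem_atlas
  · exact IsManifold.chart_mem_maximalAtlas x

/-- The function `f` in the local chart around `x`. -/
def localExpansion (x : X) (f : puncture pInf → ℂ) : ℂ → ℂ :=
  extendZero f ∘ (localChart z x).symm

lemma meromorphicAt_localExpansion (x : X) {f : puncture pInf → ℂ} (hf : f ∈ functionRing z) :
    MeromorphicAt (localExpansion z x f) (localChart z x x) := by
  rcases eq_or_ne x pInf with rfl | hx
  · unfold localExpansion
    rw [localChart_base, z.map_base]
    exact hf.2
  · exact (analyticAt_extendZero_comp_symm hf.1 (localChart_mem_maximalAtlas z x)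
      (mem_localChart_source z x) hx).meromorphicAt

/-- The order of vanishing of `f` at the point `x` of the surface. -/
def pointOrder (x : X) (f : puncture pInf → ℂ) : WithTop ℤ :=
  meromorphicOrderAt (localExpansion z x f) (localChart z x x)

lemma pointOrder_base (f : puncture pInf → ℂ) :
    pointOrder z pInf f = meromorphicOrderAt (expand z f) 0 := by
  unfold pointOrder localExpansion
  rw [localChart_base, z.map_base]
  rfl

lemma mem_poleFiltration_iff {n : ℕ} {f : puncture pInf → ℂ} (hf : f ∈ functionRing z) :
    f ∈ poleFiltration z n ↔ (-(n : ℤ) : ℤ) ≤ pointOrder z pInf f := by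
  rw [pointOrder_base]
  exact and_iff_right hf

open Topology in
lemma eventually_localExpansion_iff (x : X) (f : puncture pInf → ℂ) (p : ℂ → Prop) :
    (∀ᶠ w in 𝓝[≠] (localChart z x x), p (localExpansion z x f w)) ↔
      ∀ᶠ y in 𝓝[≠] x, p (extendZero f y) :=
  eventually_punctured_chart_iff (p := fun y => p (extendZero f y)) _ (mem_localChart_source z x)

open Topology in
lemma pointOrder_eq_top_iff (x : X) (f : puncture pInf → ℂ) :
    pointOrder z x f = ⊤ ↔ ∀ᶠ y in 𝓝[≠] x, extendZero f y = 0 := by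
  rw [pointOrder, meromorphicOrderAt_eq_top_iff]
  exact eventually_localExpansion_iff z x f (· = 0)

open Topology in
lemma pointOrder_ne_top_iff (x : X) {f : puncture pInf → ℂ} (hf : f ∈ functionRing z) :
    pointOrder z x f ≠ ⊤ ↔ ∀ᶠ y in 𝓝[≠] x, extendZero f y ≠ 0 := by
  rw [pointOrder, meromorphicOrderAt_ne_top_iff_eventually_ne_zero
    (meromorphicAt_localExpansion z x hf)]
  exact eventually_localExpansion_iff z x f (· ≠ 0)

lemma pointOrder_one (x : X) : pointOrder z x 1 = 0 := by
  have h : localExpansion z x 1 =ᶠ[nhdsWithin (localChart z x x) {localChart z x x}ᶜ]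
      fun _ => 1 := by
    refine (eventually_localExpansion_iff z x 1 (· = 1)).2 ?_
    filter_upwards [eventually_ne_base x] with y hy
    exact extendZero_of_ne 1 hy
  rw [pointOrder, meromorphicOrderAt_congr h]
  classical
  rw [meromorphicOrderAt_const, if_neg one_ne_zero]

lemma pointOrder_zero (x : X) : pointOrder z x 0 = ⊤ :=
  (pointOrder_eq_top_iff z x 0).2 <| by
    filter_upwards [eventually_ne_base x] with y hy
    exact extendZero_of_ne 0 hy

lemma pointOrder_mul (x : X) {f g : puncture pInf → ℂ} (hf : f ∈ functionRing z)
    (hg : g ∈ functionRing z) : pointOrder z x (f * g) = pointOrder z x f + pointOrder z x g := by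
  have h : localExpansion z x (f * g) = localExpansion z x f * localExpansion z x g := by
    unfold localExpansion
    rw [extendZero_mul]
    rfl
  rw [pointOrder, h]
  exact meromorphicOrderAt_mul (meromorphicAt_localExpansion z x hf)
    (meromorphicAt_localExpansion z x hg)

lemma le_pointOrder_add (x : X) {f g : puncture pInf → ℂ} (hf : f ∈ functionRing z)
    (hg : g ∈ functionRing z) :
    min (pointOrder z x f) (pointOrder z x g) ≤ pointOrder z x (f + g) := by
  have h : localExpansion z x (f + g) = localExpansion z x f + localExpansion z x g := by
    unfold localExpansion
    rw [extendZero_add]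
    rfl
  unfold pointOrder
  rw [h]
  exact meromorphicOrderAt_add (meromorphicAt_localExpansion z x hf)
    (meromorphicAt_localExpansion z x hg)

lemma continuousAt_extendZero {f : puncture pInf → ℂ} (hf : f ∈ functionRing z) {x : X}
    (hx : x ≠ pInf) : ContinuousAt (extendZero f) x :=
  (mdifferentiableAt_extendZero.2 (hf.1 ⟨x, hx⟩)).continuousAt

lemma pointOrder_nonneg {f : puncture pInf → ℂ} (hf : f ∈ functionRing z) {x : X}
    (hx : x ≠ pInf) : 0 ≤ pointOrder z x f :=
  (analyticAt_extendZero_comp_symm hf.1 (localChart_mem_maximalAtlas z x)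
    (mem_localChart_source z x) hx).meromorphicOrderAt_nonneg

open Topology in
-- This is the identity theorem. In a punctured neighbourhood a meromorphic function is either
-- identically zero or nowhere zero, so the points of infinite order form a clopen set. Continuity
-- then recovers the values at the points themselves.
lemma eq_zero_of_pointOrder_eq_top [PreconnectedSpace X] {f : puncture pInf → ℂ}
    (hf : f ∈ functionRing z) {x : X} (hx : pointOrder z x f = ⊤) : f = 0 := by
  have hspread : ∀ (p : ℂ → Prop) (y : X), (∀ᶠ y' in 𝓝[≠] y, p (extendZero f y')) →
      ∀ᶠ y' in 𝓝 y, ∀ᶠ y'' in 𝓝[≠] y', p (extendZero f y'') := by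
    intro p y h
    have h1 := eventually_eventually_nhdsWithin.2 h
    rw [eventually_nhdsWithin_iff] at h1
    filter_upwards [h1] with y' hy'
    rcases eq_or_ne y' y with rfl | hne
    · exact h
    · have h2 := hy' hne
      rw [nhdsWithin_eq_nhds.2 (isOpen_compl_singleton.mem_nhds hne)] at h2
      exact h2.filter_mono nhdsWithin_le_nhds
  have hopen : IsOpen {y : X | pointOrder z y f = ⊤} := by
    refine isOpen_iff_mem_nhds.2 fun y hy => ?_
    filter_upwards [hspread (· = 0) y ((pointOrder_eq_top_iff z y f).1 hy)] with y' hy'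
    exact (pointOrder_eq_top_iff z y' f).2 hy'
  have hclosed : IsOpen {y : X | pointOrder z y f = ⊤}ᶜ := by
    refine isOpen_iff_mem_nhds.2 fun y hy => ?_
    filter_upwards [hspread (· ≠ 0) y ((pointOrder_ne_top_iff z y hf).1 hy)] with y' hy'
    exact (pointOrder_ne_top_iff z y' hf).2 hy'
  have huniv := IsClopen.eq_univ ⟨⟨hclosed⟩, hopen⟩ ⟨x, hx⟩
  funext y
  have hy : pointOrder z (y : X) f = ⊤ := huniv.ge (Set.mem_univ (y : X))
  rw [pointOrder_eq_top_iff] at hy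
  have := neBot_punctured (y : X)
  rw [← extendZero_coe f y]
  exact tendsto_nhds_unique_of_eventuallyEq
    ((continuousAt_extendZero z hf y.2).tendsto.mono_left nhdsWithin_le_nhds)
    tendsto_const_nhds hy

lemma pointOrder_ne_top [PreconnectedSpace X] {f : puncture pInf → ℂ} (hf : f ∈ functionRing z)
    (hf0 : f ≠ 0) (x : X) : pointOrder z x f ≠ ⊤ :=
  fun h => hf0 (eq_zero_of_pointOrder_eq_top z hf h)

instance isDomain_functionRing [PreconnectedSpace X] : IsDomain (functionRing z) := by
  have : Nontrivial (functionRing z) := by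
    refine ⟨⟨0, 1, fun h => ?_⟩⟩
    have h0 := pointOrder_zero z pInf
    rw [show (0 : puncture pInf → ℂ) = 1 from congrArg Subtype.val h, pointOrder_one] at h0
    exact WithTop.coe_ne_top h0
  have : NoZeroDivisors (functionRing z) := by
    refine ⟨fun {f g} h => ?_⟩
    have h0 : (f : puncture pInf → ℂ) * g = 0 := congrArg Subtype.val h
    have h1 := pointOrder_mul z pInf f.2 g.2
    rw [h0, pointOrder_zero, eq_comm, WithTop.add_eq_top] at h1
    exact h1.imp (fun h => Subtype.ext (eq_zero_of_pointOrder_eq_top z f.2 h))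
      fun h => Subtype.ext (eq_zero_of_pointOrder_eq_top z g.2 h)
  exact NoZeroDivisors.to_isDomain _

/-- The order of vanishing at `x` as a valuation of the ring of functions. -/
def pointValuation (x : X) : AddValuation (functionRing z) (WithTop ℤ) :=
  AddValuation.of (fun f => pointOrder z x f) (pointOrder_zero z x) (pointOrder_one z x)
    (fun f g => le_pointOrder_add z x f.2 g.2) (fun f g => pointOrder_mul z x f.2 g.2)

lemma withTop_sub_nonneg {a b : WithTop ℤ} (hb : b ≠ ⊤) (h : b ≤ a) : 0 ≤ a - b := by
  lift b to ℤ using hb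
  induction a using WithTop.recTopCoe with
  | top => exact le_top
  | coe a => exact WithTop.coe_le_coe.2 (sub_nonneg.2 (WithTop.coe_le_coe.1 h))

open Filter Topology in
-- By the inequality of orders, `f / g` has only removable singularities away from `pInf`; at `pInf`
-- it is a quotient of meromorphic functions.
lemma exists_mul_eq_of_pointOrder_le [PreconnectedSpace X] {f g : puncture pInf → ℂ}
    (hf : f ∈ functionRing z) (hg : g ∈ functionRing z) (hg0 : g ≠ 0)
    (h : ∀ x ≠ pInf, pointOrder z x g ≤ pointOrder z x f) : ∃ q ∈ functionRing z, q * g = f := by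
  set Q : X → ℂ := extendZero f / extendZero g with hQ
  -- Punctured limits give the right value also at the zeros of `g`, where pointwise division
  -- returns `0`.
  set q : X → ℂ := fun x => limUnder (𝓝[≠] x) Q with hq
  have hgne : ∀ x, ∀ᶠ y in 𝓝[≠] x, extendZero g y ≠ 0 := fun x =>
    (pointOrder_ne_top_iff z x hg).1 (pointOrder_ne_top z hg hg0 x)
  have hlocal : ∀ x ≠ pInf, MDifferentiableAt 𝓘(ℂ) 𝓘(ℂ) q x := by
    intro x hx
    set e := localChart z x with he
    have hxe : x ∈ e.source := mem_localChart_source z x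
    have hmf := meromorphicAt_localExpansion z x hf
    have hmg := meromorphicAt_localExpansion z x hg
    have hord : 0 ≤ meromorphicOrderAt (localExpansion z x f / localExpansion z x g) (e x) := by
      rw [meromorphicOrderAt_div hmf hmg]
      have h1 := h x hx
      have h2 := pointOrder_ne_top z hg hg0 x
      unfold pointOrder at h1 h2
      exact withTop_sub_nonneg h2 h1
    obtain ⟨φ, hφ, hφQ⟩ := (hmf.div hmg).meromorphicOrderAt_nonneg_iff.1 hord
    have hQφ : ∀ᶠ y in 𝓝[≠] x, Q y = φ (e y) := by
      refine (eventually_punctured_chart_iff e hxe).1 ?_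
      filter_upwards [hφQ, nhdsWithin_le_nhds (e.open_target.mem_nhds (e.map_source hxe))]
        with w hw hwt
      rw [e.right_inv hwt, ← hw]
      rfl
    -- The agreement is spread to punctured neighbourhoods of all points near `x`, so that the
    -- limits defining `q` are computed by `φ` on a full neighbourhood, including `x`.
    have hQφ' : ∀ᶠ y in 𝓝 x, ∀ᶠ y' in 𝓝[≠] y, Q y' = φ (e y') := by
      have h1 := eventually_eventually_nhdsWithin.2 hQφ
      rw [eventually_nhdsWithin_iff] at h1
      filter_upwards [h1] with y hy
      rcases eq_or_ne y x with rfl | hne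
      · exact hQφ
      · have h2 := hy hne
        rw [nhdsWithin_eq_nhds.2 (isOpen_compl_singleton.mem_nhds hne)] at h2
        exact h2.filter_mono nhdsWithin_le_nhds
    have hqφ : q =ᶠ[𝓝 x] φ ∘ e := by
      filter_upwards [hQφ', e.open_source.mem_nhds hxe,
        (e.continuousAt hxe).eventually hφ.eventually_analyticAt] with y hy hys hya
      have := neBot_punctured y
      refine Filter.Tendsto.limUnder_eq (Filter.Tendsto.congr' (Filter.EventuallyEq.symm hy) ?_)
      exact (hya.continuousAt.comp (e.continuousAt hys)).tendsto.mono_left nhdsWithin_le_nhds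
    refine MDifferentiableAt.congr_of_eventuallyEq ?_ hqφ
    refine MDifferentiableAt.comp x hφ.differentiableAt.mdifferentiableAt ?_
    exact ((contMDiffOn_of_mem_maximalAtlas (localChart_mem_maximalAtlas z x)).contMDiffAt
      (e.open_source.mem_nhds hxe)).mdifferentiableAt (by simp)
  have hval : ∀ x ≠ pInf, extendZero g x ≠ 0 → q x = Q x := by
    intro x hx hgx
    have := neBot_punctured x
    refine Filter.Tendsto.limUnder_eq ?_
    exact ((continuousAt_extendZero z hf hx).div (continuousAt_extendZero z hg hx)
      hgx).tendsto.mono_left nhdsWithin_le_nhds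
  have hmul : ∀ x ≠ pInf, q x * extendZero g x = extendZero f x := by
    intro x hx
    have := neBot_punctured x
    refine tendsto_nhds_unique_of_eventuallyEq (l := 𝓝[≠] x)
      (f := fun y => q y * extendZero g y) (g := extendZero f)
      (((hlocal x hx).continuousAt.mul (continuousAt_extendZero z hg hx)).tendsto.mono_left
        nhdsWithin_le_nhds)
      ((continuousAt_extendZero z hf hx).tendsto.mono_left nhdsWithin_le_nhds) ?_
    filter_upwards [hgne x, eventually_ne_base x] with y hy hyp
    rw [hval y hyp hy]
    exact div_mul_cancel₀ _ hy
  refine ⟨fun x => q x, ⟨fun x => ?_, ?_⟩, ?_⟩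
  · refine mdifferentiableAt_extendZero.1 ((hlocal x x.2).congr_of_eventuallyEq ?_)
    filter_upwards [isOpen_compl_singleton.mem_nhds x.2] with y hy
    exact extendZero_of_ne _ hy
  · refine (hf.2.div hg.2).congr ?_
    have h1 := hgne pInf
    have h2 : ∀ᶠ y in 𝓝[≠] pInf, Q y = extendZero (fun x : puncture pInf => q x) y := by
      filter_upwards [h1, eventually_ne_base pInf] with y hy hyp
      rw [extendZero_of_ne _ hyp]
      exact (hval y hyp hy).symm
    have h3 := (eventually_punctured_chart_iff z.chart z.mem_source).2 h2
    rw [z.map_base] at h3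
    exact h3
  · funext x
    have := hmul x x.2
    rwa [extendZero_coe, extendZero_coe] at this

end Surface

/-! ### Finite codimension, localizations of integrally closed domains, and valuations of the
quotient field. -/

section Algebra

lemma isIntegralElem_of_comp {A B K : Type*} [CommRing A] [CommRing B] [CommRing K]
    {f : A →+* K} {g : B →+* K} (h : A →+* B) (hgh : g.comp h = f) {x : K}
    (hx : f.IsIntegralElem x) : g.IsIntegralElem x := by
  obtain ⟨p, hp, hpx⟩ := hx
  refine ⟨p.map h, hp.map h, ?_⟩
  rw [Polynomial.eval₂_map, hgh, hpx]

/-- A subalgebra `B ≤ A` such that linear independence in `A` modulo `B` can be tested by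
finitely many linear functionals is of finite codimension; hence `A` is finite over `B`. -/
lemma finite_inclusion_of_functionals {k S κ : Type*} [Field k] [CommRing S] [Algebra k S]
    [Fintype κ] {B A : Subalgebra k S} (h : B ≤ A)
    (H : ∀ (d : ℕ) (x : Fin d → S), (∀ i, x i ∈ A) → ∃ ev : Fin d → κ → k,
      ∀ c : Fin d → k, ∑ i, c i • ev i = 0 → ∑ i, c i • x i ∈ B) :
    (Subalgebra.inclusion h).toRingHom.Finite := by
  classical
  set n : Submodule k A := (Subalgebra.toSubmodule B).comap A.val.toLinearMap with hn
  have hrank : Module.rank k (A ⧸ n) ≤ (Fintype.card κ : ℕ) := by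
    -- It suffices to bound the size of a finite independent family. Its vectors `ev i` are
    -- independent in `κ → k`, since a relation between them puts the combination into `B`, that is,
    -- makes it zero in the quotient. The functionals may depend on the family, which leaves room
    -- for a choice of common denominator.
    refine rank_le fun s hs => ?_
    replace hs := hs.comp _ s.equivFin.symm.injective
    choose r hr using fun i => n.mkQ_surjective (s.equivFin.symm i : A ⧸ n)
    obtain ⟨ev, hev⟩ := H s.card (fun i => (r i : S)) fun i => (r i).2
    have hli : LinearIndependent k ev := by
      refine Fintype.linearIndependent_iff.2 fun c hc => ?_
      refine Fintype.linearIndependent_iff.1 hs c ?_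
      have h1 : ∑ q, c q • r q ∈ n := by
        change ((∑ q, c q • r q : A) : S) ∈ B
        have := hev c hc
        simpa using this
      replace h1 : n.mkQ (∑ q, c q • r q) = 0 := (Submodule.Quotient.mk_eq_zero n).2 h1
      rw [map_sum] at h1
      simpa [hr, -Submodule.mkQ_apply] using h1
    have := hli.fintype_card_le_finrank
    simpa using this
  have hfin : Module.Finite k (A ⧸ n) :=
    Module.rank_lt_aleph0_iff.1 (hrank.trans_lt (Cardinal.natCast_lt_aleph0))
  let : Algebra B A := (Subalgebra.inclusion h).toRingHom.toAlgebra
  have : IsScalarTower k B A := IsScalarTower.of_algebraMap_eq fun _ => rfl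
  -- As a `B`-module, `A` is generated by `1`, which accounts for `B` itself, and by lifts of
  -- generators of the quotient.
  obtain ⟨T, hT⟩ := hfin.fg_top
  choose r hr using n.mkQ_surjective
  set s : Submodule B A := Submodule.span B ↑(insert 1 (T.image r)) with hs
  have hns : n ≤ s.restrictScalars k := by
    intro y hy
    have h1 : (1 : A) ∈ s := Submodule.subset_span (Finset.mem_insert_self _ _)
    have h2 := s.smul_mem ⟨y, hy⟩ h1
    have h3 : (⟨y, hy⟩ : B) • (1 : A) = y := Subtype.ext (mul_one (y : S))
    rwa [h3] at h2
  have hTs : ⊤ ≤ (s.restrictScalars k).map n.mkQ := by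
    rw [← hT, Submodule.span_le]
    intro q hq
    exact ⟨r q, Submodule.subset_span (Finset.mem_insert_of_mem (Finset.mem_image_of_mem r hq)),
      hr q⟩
  refine ⟨⟨insert 1 (T.image r), top_le_iff.1 fun y _ => ?_⟩⟩
  obtain ⟨w, hw, hwy⟩ := hTs (Submodule.mem_top (x := n.mkQ y))
  have h1 : y - w ∈ n := by
    rw [← n.ker_mkQ, LinearMap.mem_ker, map_sub, hwy, sub_self]
  have h2 := s.add_mem (hns h1) hw
  rwa [sub_add_cancel] at h2

variable {R K : Type*} [CommRing R] [IsDomain R] [Field K] [Algebra R K] [IsFractionRing R K]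

variable (K) in
lemma algebraMap_fraction_ne_zero {a : R} (ha : a ≠ 0) : algebraMap R K a ≠ 0 :=
  (map_ne_zero_iff _ (IsFractionRing.injective R K)).2 ha

variable (R) in
lemma exists_mul_algebraMap_eq (y : K) :
    ∃ f g : R, g ≠ 0 ∧ y * algebraMap R K g = algebraMap R K f := by
  obtain ⟨⟨f, g⟩, h⟩ := IsLocalization.surj (nonZeroDivisors R) y
  exact ⟨f, g, nonZeroDivisors.ne_zero g.2, h⟩

/-- The localization `R[1/a]` of an integrally closed domain is integrally closed. -/
lemma exists_mul_pow_eq_of_isIntegralElem [IsIntegrallyClosed R] {a : R} (ha : a ≠ 0)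
    {B : Subring K} (hB : ∀ b ∈ B, ∃ n, ∃ f : R, b * algebraMap R K a ^ n = algebraMap R K f)
    {y : K} (hy : (B.subtype).IsIntegralElem y) :
    ∃ n, ∃ f : R, y * algebraMap R K a ^ n = algebraMap R K f := by
  have hM : Submonoid.powers a ≤ nonZeroDivisors R :=
    powers_le_nonZeroDivisors_of_noZeroDivisors ha
  have ha' := algebraMap_fraction_ne_zero K ha
  let O := Localization.subalgebra.ofField K (Submonoid.powers a) hM
  have hmem : ∀ b : K, b ∈ O ↔
      ∃ n, ∃ f : R, b * algebraMap R K a ^ n = algebraMap R K f := by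
    intro b
    constructor
    · rintro ⟨f, _, ⟨n, rfl⟩, rfl⟩
      refine ⟨n, f, ?_⟩
      rw [map_pow, inv_mul_cancel_right₀ (pow_ne_zero n ha')]
    · rintro ⟨n, f, h⟩
      refine ⟨f, _, ⟨n, rfl⟩, ?_⟩
      rw [map_pow, ← h, mul_inv_cancel_right₀ (pow_ne_zero n ha')]
  -- `O` is `R[1/a]` inside `K`. It contains `B`, so integrality over `B` passes to `O`.
  have : IsIntegrallyClosed O := isIntegrallyClosed_of_isLocalization O (Submonoid.powers a) hM
  have hint : IsIntegral O y := isIntegralElem_of_comp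
    (B.subtype.codRestrict O fun b => (hmem b).2 (hB b b.2)) rfl hy
  obtain ⟨w, rfl⟩ := IsIntegrallyClosed.isIntegral_iff.1 hint
  exact (hmem _).1 w.2

section Valuation

variable (K) {Γ : Type*} [LinearOrderedCommGroupWithZero Γ] (v : Valuation R Γ)
  (hv : ∀ f, v f = 0 → f = 0)

/-- The extension to the quotient field of a valuation with trivial support. -/
def fractionValuation : Valuation K Γ :=
  v.extendToLocalization (S := nonZeroDivisors R)
    (fun _ hf h => nonZeroDivisors.ne_zero hf (hv _ h)) K

variable {K}

lemma fractionValuation_le_one_iff {y : K} {f g : R} (hg : g ≠ 0)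
    (h : y * algebraMap R K g = algebraMap R K f) :
    fractionValuation K v hv y ≤ 1 ↔ v f ≤ v g := by
  have hval : ∀ f : R, fractionValuation K v hv (algebraMap R K f) = v f :=
    Valuation.extendToLocalization_apply_map_apply _ _ _
  rw [← hval f, ← h, map_mul, hval]
  exact (mul_le_iff_le_one_left (zero_lt_iff.2 fun h0 => hg (hv g h0))).symm

/-- Valuation rings are integrally closed, and the image of `B` lies in the one of this valuation.
-/
lemma fractionValuation_le_one_of_isIntegralElem {B : Type*} [CommRing B] {j : B →+* K}
    (hB : ∀ b, fractionValuation K v hv (j b) ≤ 1) {y : K} (hy : j.IsIntegralElem y) :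
    fractionValuation K v hv y ≤ 1 := by
  refine (Valuation.integer.integers (fractionValuation K v hv)).mem_of_integral ?_
  exact isIntegralElem_of_comp (j.codRestrict (fractionValuation K v hv).integer hB) rfl hy

end Valuation

end Algebra

/-! ### Integral closedness of `R` and of the charts of `C`. -/

section Surface

variable {X : Type u} [TopologicalSpace X] [T2Space X] {pInf : X} [ChartedSpace ℂ X]
  [IsManifold 𝓘(ℂ) ω X] [PreconnectedSpace X] (z : LocalCoordinate pInf)

lemma eq_zero_of_pointValuation (x : X) (f : functionRing z)
    (h : (pointValuation z x).toValuation f = 0) : f = 0 :=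
  Subtype.ext (eq_zero_of_pointOrder_eq_top z f.2 (x := x) h)

/-- The order of vanishing at `x` as a valuation of the function field. -/
def fieldValuation (x : X) :
    Valuation (functionField z) (Multiplicative (WithTop ℤ)ᵒᵈ) :=
  fractionValuation (functionField z) (pointValuation z x).toValuation
    (eq_zero_of_pointValuation z x)

variable {z}

/-- The value group carries the reversed order, so a value at most `1` means a nonnegative order of
vanishing. -/
lemma fieldValuation_le_one_iff (x : X) {y : functionField z} {f g : functionRing z} (hg : g ≠ 0)
    (h : y * algebraMap (functionRing z) (functionField z) g =
      algebraMap (functionRing z) (functionField z) f) :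
    fieldValuation z x y ≤ 1 ↔
      pointOrder z x (g : puncture pInf → ℂ) ≤ pointOrder z x (f : puncture pInf → ℂ) :=
  fractionValuation_le_one_iff (pointValuation z x).toValuation _ hg h

lemma fieldValuation_le_one_of_isIntegralElem (x : X) {B : Type*} [CommRing B]
    {j : B →+* functionField z} (hB : ∀ b, fieldValuation z x (j b) ≤ 1) {y : functionField z}
    (hy : j.IsIntegralElem y) : fieldValuation z x y ≤ 1 :=
  fractionValuation_le_one_of_isIntegralElem (pointValuation z x).toValuation _ hB hy

variable (z) in
-- Elements of `R` have nonnegative order away from `pInf`, hence so has an integral fraction, and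
-- such a fraction is again in `R`. Its behaviour at `pInf` needs no bound, since poles of any order
-- are allowed there.
instance isIntegrallyClosed_functionRing : IsIntegrallyClosed (functionRing z) := by
  refine (isIntegrallyClosed_iff (functionField z)).2 fun {y} hy => ?_
  obtain ⟨f, g, hg, h⟩ := exists_mul_algebraMap_eq (functionRing z) y
  have hord : ∀ x ≠ pInf, pointOrder z x (g : puncture pInf → ℂ) ≤
      pointOrder z x (f : puncture pInf → ℂ) := by
    intro x hx
    refine (fieldValuation_le_one_iff x hg h).1
      (fieldValuation_le_one_of_isIntegralElem x (fun b => ?_) hy)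
    refine (fieldValuation_le_one_iff x (f := b) (g := 1) one_ne_zero (by simp)).2 ?_
    exact (pointOrder_one z x).trans_le (pointOrder_nonneg z b.2 hx)
  obtain ⟨q, hq, hqg⟩ := exists_mul_eq_of_pointOrder_le z f.2 g.2
    (fun h => hg (Subtype.ext h)) hord
  refine ⟨⟨q, hq⟩, ?_⟩
  refine mul_right_cancel₀ (algebraMap_fraction_ne_zero (functionField z) hg) ?_
  rw [h, ← map_mul]
  exact congrArg _ (Subtype.ext hqg)

lemma poleFiltration_mono {m n : ℕ} (h : m ≤ n) : poleFiltration z m ≤ poleFiltration z n :=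
  fun _ hf => ⟨hf.1, le_trans (WithTop.coe_le_coe.2 (by omega)) hf.2⟩

lemma exists_mem_poleFiltration (f : functionRing z) :
    ∃ n, (f : puncture pInf → ℂ) ∈ poleFiltration z n := by
  rcases eq_or_ne (pointOrder z pInf (f : puncture pInf → ℂ)) ⊤ with h | h
  · exact ⟨0, (mem_poleFiltration_iff z f.2).2 (h ▸ le_top)⟩
  · lift pointOrder z pInf (f : puncture pInf → ℂ) to ℤ using h with d hd
    refine ⟨d.natAbs, (mem_poleFiltration_iff z f.2).2 ?_⟩
    rw [← hd]
    exact WithTop.coe_le_coe.2 (by omega)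

lemma pointOrder_pow (x : X) (f : functionRing z) (n : ℕ) :
    pointOrder z x ((f ^ n : functionRing z) : puncture pInf → ℂ) =
      n • pointOrder z x (f : puncture pInf → ℂ) :=
  (pointValuation z x).map_pow f n

/-- For `a` with a pole of order less than `m`, the chart of `a` in degree `m` contains `R[1/a]`. -/
lemma mem_chartRing_of_pole_lt {m : ℕ} {a : functionRing z}
    (ha : (a : puncture pInf → ℂ) ∈ poleFiltration z m)
    (hlt : (a : puncture pInf → ℂ) ∈ poleFiltration z (m - 1)) (hm : 1 ≤ m)
    {y : functionField z} {n : ℕ} {f : functionRing z}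
    (h : y * algebraMap (functionRing z) (functionField z) a ^ n =
      algebraMap (functionRing z) (functionField z) f) :
    y ∈ chartRing (poleFiltration z) ha := by
  -- Each further factor `a` raises the pole allowance by `m` but the pole itself by at most `m -
  -- 1`. Expanding the fraction by `a ^ l`, with `l` a bound for the pole of `f`, therefore
  -- suffices.
  obtain ⟨l, hl⟩ := exists_mem_poleFiltration f
  refine ⟨n + l, f * a ^ l, ?_, ?_⟩
  · refine poleFiltration_mono ?_ (SetLike.mul_mem_graded hl (SetLike.pow_mem_graded l hlt))
    have : l + l * (m - 1) = l * m := by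
      obtain ⟨k, rfl⟩ := Nat.exists_eq_add_of_le' hm
      simp [mul_add, add_comm]
    rw [smul_eq_mul, this]
    exact Nat.mul_le_mul_right m (Nat.le_add_left l n)
  · rw [pow_add, ← mul_assoc, h, map_mul, map_pow]

/-- The charts of `Proj (⨁ n, R(n))` are integrally closed. -/
lemma mem_chartRing_of_isIntegralElem {m : ℕ} {a : functionRing z}
    (ha : (a : puncture pInf → ℂ) ∈ poleFiltration z m) (hm : 1 ≤ m) (ha0 : a ≠ 0)
    {y : functionField z}
    (hy : (algebraMap (chartRing (poleFiltration z) ha) (functionField z)).IsIntegralElem y) :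
    y ∈ chartRing (poleFiltration z) ha := by
  obtain ⟨n, f, h⟩ := exists_mul_pow_eq_of_isIntegralElem ha0
    (B := (chartRing (poleFiltration z) ha).toSubring)
    (fun b ⟨n, f, _, h⟩ => ⟨n, f, h⟩) hy
  by_cases hlt : (a : puncture pInf → ℂ) ∈ poleFiltration z (m - 1)
  · exact mem_chartRing_of_pole_lt ha hlt hm h
  -- The order is at least `-m` but less than `-(m - 1)`; since `1 ≤ m`, the natural subtraction is
  -- not truncated.
  have horder : pointOrder z pInf (a : puncture pInf → ℂ) = (-(m : ℤ) : ℤ) := by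
    have h1 := (mem_poleFiltration_iff z a.2).1 ha
    rw [mem_poleFiltration_iff z a.2, not_le] at hlt
    have h2 := pointOrder_ne_top z a.2 (fun h => ha0 (Subtype.ext h)) pInf
    lift pointOrder z pInf (a : puncture pInf → ℂ) to ℤ using h2 with d
    have h3 := WithTop.coe_le_coe.1 h1
    have h4 := WithTop.coe_lt_coe.1 hlt
    exact congrArg _ (by omega)
  have hpow : ∀ n : ℕ, pointOrder z pInf ((a ^ n : functionRing z) : puncture pInf → ℂ) =
      (-((n * m : ℕ) : ℤ) : ℤ) := by
    intro n
    rw [pointOrder_pow, horder, ← WithTop.coe_nsmul]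
    exact congrArg _ (by simp)
  -- On the chart a pole of the numerator is compensated by that of `a ^ n`, so the chart lies in
  -- the valuation ring at `pInf`, and `y` does too. This bounds the pole of `f`.
  have hval : fieldValuation z pInf y ≤ 1 := by
    refine fieldValuation_le_one_of_isIntegralElem pInf ?_ hy
    rintro ⟨b, n, u, hu, hb⟩
    refine (fieldValuation_le_one_iff pInf (f := u) (g := a ^ n) (pow_ne_zero n ha0)
      (by rw [map_pow]; exact hb)).2 ?_
    rw [hpow]
    exact (mem_poleFiltration_iff z u.2).1 hu
  refine ⟨n, f, (mem_poleFiltration_iff z f.2).2 ?_, h⟩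
  rw [← hpow]
  exact (fieldValuation_le_one_iff pInf (f := f) (g := a ^ n) (pow_ne_zero n ha0)
    (by rw [map_pow]; exact h)).1 hval

end Surface

/-! ### Finiteness over `R_e` and over its charts; the quotient field of `R_e`. -/

namespace VertexData

variable {X : Type u} [TopologicalSpace X] [T2Space X] {pInf : X} [ChartedSpace ℂ X]
  [IsManifold 𝓘(ℂ) ω X] {z : LocalCoordinate pInf}
  {E : X → Type v} [∀ x, AddCommGroup (E x)] [∀ x, Module ℂ (E x)]
  [∀ x, TopologicalSpace (E x)] [TopologicalSpace (Bundle.TotalSpace ℂ E)]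
  [FiberBundle ℂ E] [VectorBundle ℂ ℂ E] {N M : ℕ} (D : VertexData z E N M)

/-- The points `P i` and `Q j`. -/
def point : Fin N ⊕ Fin M → puncture pInf := Sum.elim D.P D.Q

lemma mem_Re_of_point {f : puncture pInf → ℂ} (hf : f ∈ functionRing z)
    (h : ∀ k, f (D.point k) = 0) : f ∈ D.Re :=
  D.mem_Re_of_vanish hf (fun i => h (Sum.inl i)) fun j => h (Sum.inr j)

/-- The functionals are the evaluations at the `N + M` points; their common kernel lies in `R_e`. -/
lemma finite_inclusion_Re : (Subalgebra.inclusion D.Re_le).toRingHom.Finite := by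
  refine finite_inclusion_of_functionals (κ := Fin N ⊕ Fin M) D.Re_le fun d x hx =>
    ⟨fun i k => x i (D.point k), fun c hc => D.mem_Re_of_point ?_ fun k => ?_⟩
  · exact sum_mem fun i _ => Subalgebra.smul_mem _ (hx i) (c i)
  · have := congrFun hc k
    simpa using this

/-- Elements of the chart need not have values at the points, because `a` may vanish there. Instead
a finite family is written over one power of `a` and its numerators are evaluated. -/
lemma finite_inclusion_chartRing {m : ℕ} {a : functionRing z}
    (ha : (a : puncture pInf → ℂ) ∈ D.ReFiltration m) :
    (Subalgebra.inclusion (chartRing_mono D.ReFiltration_le ha)).toRingHom.Finite := by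
  refine finite_inclusion_of_functionals (κ := Fin N ⊕ Fin M) _ fun d x hx => ?_
  choose n u hu h using hx
  -- The sum of the exponents serves as a common bound for all of them.
  set w : Fin d → functionRing z := fun i => u i * a ^ (∑ i', n i' - n i) with hw
  have hn : ∀ i, n i + (∑ i', n i' - n i) = ∑ i', n i' := fun i =>
    Nat.add_sub_cancel' (Finset.single_le_sum (f := n) (fun _ _ => Nat.zero_le _)
      (Finset.mem_univ i))
  have hwmem : ∀ i, (w i : puncture pInf → ℂ) ∈ poleFiltration z ((∑ i', n i') * m) := by
    intro i
    have h1 := SetLike.mul_mem_graded (hu i)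
      (SetLike.pow_mem_graded (∑ i', n i' - n i) (D.ReFiltration_le m ha))
    rw [smul_eq_mul, ← add_mul, hn] at h1
    exact h1
  have hwx : ∀ i, x i * algebraMap (functionRing z) (functionField z) a ^ (∑ i', n i') =
      algebraMap (functionRing z) (functionField z) (w i) := by
    intro i
    rw [map_mul, map_pow, ← h i, mul_assoc, ← pow_add, hn]
  refine ⟨fun i k => (w i : puncture pInf → ℂ) (D.point k), fun c hc =>
    ⟨∑ i', n i', ∑ i, c i • w i, ?_, ?_⟩⟩
  · have h1 : ((∑ i, c i • w i : functionRing z) : puncture pInf → ℂ) =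
        ∑ i, c i • (w i : puncture pInf → ℂ) := by simp
    rw [h1]
    refine ⟨sum_mem fun i _ => Submodule.smul_mem _ (c i) (hwmem i), ?_⟩
    refine D.mem_Re_of_point
      (sum_mem fun i _ => Subalgebra.smul_mem _ (w i).2 (c i)) fun k => ?_
    have := congrFun hc k
    simpa using this
  · rw [Finset.sum_mul, map_sum]
    refine Finset.sum_congr rfl fun i _ => ?_
    rw [smul_mul_assoc, hwx]
    exact ((Algebra.linearMap (functionRing z) (functionField z)).map_smul_of_tower _ _).symm

/-- The function field is the quotient field of `R_e`. -/
lemma exists_mul_eq_of_Re [PreconnectedSpace X] (y : functionField z) :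
    ∃ f g : functionRing z, (f : puncture pInf → ℂ) ∈ D.Re ∧ (g : puncture pInf → ℂ) ∈ D.Re ∧
      g ≠ 0 ∧ y * algebraMap (functionRing z) (functionField z) g =
        algebraMap (functionRing z) (functionField z) f := by
  obtain ⟨f, g, hg, h⟩ := exists_mul_algebraMap_eq (functionRing z) y
  -- In the first case `f / g = (f c) / (g c)`, with both terms in `R_e` because `c` vanishes at all
  -- the points.
  by_cases hc : ∃ c : functionRing z, c ≠ 0 ∧ ∀ k, (c : puncture pInf → ℂ) (D.point k) = 0
  · obtain ⟨c, hc0, hc⟩ := hc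
    have hmem : ∀ w : functionRing z, ((w * c : functionRing z) : puncture pInf → ℂ) ∈ D.Re :=
      fun w => D.mem_Re_of_point (w * c).2 fun k => mul_eq_zero_of_right _ (hc k)
    refine ⟨f * c, g * c, hmem f, hmem g, mul_ne_zero hg hc0, ?_⟩
    rw [map_mul, map_mul, ← mul_assoc, h]
  -- Otherwise evaluation at the points is injective, so `R` is a finite-dimensional domain over
  -- `ℂ`. It then equals `ℂ`, and the constants lie in `R_e`.
  · push Not at hc
    let ev : functionRing z →ₗ[ℂ] (Fin N ⊕ Fin M → ℂ) :=
      { toFun := fun w k => (w : puncture pInf → ℂ) (D.point k)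
        map_add' := fun _ _ => rfl
        map_smul' := fun _ _ => rfl }
    have hev : Function.Injective ev := by
      refine (injective_iff_map_eq_zero ev).2 fun w hw => ?_
      by_contra hw0
      obtain ⟨k, hk⟩ := hc w hw0
      exact hk (congrFun hw k)
    have : Module.Finite ℂ (functionRing z) := Module.Finite.of_injective ev hev
    have hsurj := (IsAlgClosed.algebraMap_bijective_of_isIntegral
      (k := ℂ) (K := functionRing z)).2
    have hmem : ∀ w : functionRing z, (w : puncture pInf → ℂ) ∈ D.Re := by
      intro w
      obtain ⟨c, rfl⟩ := hsurj w
      exact algebraMap_mem D.Re c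
    exact ⟨f, g, hmem f, hmem g, hg, h⟩

end VertexData

/-! ### Integrally closed homomorphisms and a criterion for normalization. -/

section IntegrallyClosedIn

/-- `φ` is injective and its target contains no further elements that are integral over it. -/
def IsIntegrallyClosedHom {R S : Type*} [CommRing R] [CommRing S] (φ : R →+* S) : Prop :=
  Function.Injective φ ∧ ∀ c, φ.IsIntegralElem c → c ∈ φ.range

lemma isIntegralElem_of_injective_comp {R S S' : Type*} [CommRing R] [CommRing S] [CommRing S']
    {φ : R →+* S} {ε : S →+* S'} (hε : Function.Injective ε) {c : S}
    (hc : (ε.comp φ).IsIntegralElem (ε c)) : φ.IsIntegralElem c := by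
  obtain ⟨p, hp, h⟩ := hc
  refine ⟨p, hp, hε ?_⟩
  rw [Polynomial.hom_eval₂, h, map_zero]

lemma IsIntegrallyClosedHom.comp_bijective {R S S' : Type*} [CommRing R] [CommRing S]
    [CommRing S'] {φ : R →+* S} (h : IsIntegrallyClosedHom φ) {ε : S →+* S'}
    (hε : Function.Bijective ε) : IsIntegrallyClosedHom (ε.comp φ) := by
  refine ⟨hε.1.comp h.1, fun c hc => ?_⟩
  obtain ⟨c, rfl⟩ := hε.2 c
  obtain ⟨b, rfl⟩ := h.2 c (isIntegralElem_of_injective_comp hε.1 hc)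
  exact ⟨b, rfl⟩

lemma IsIntegrallyClosedHom.comp_equiv {R R' S : Type*} [CommRing R] [CommRing R'] [CommRing S]
    {φ : R' →+* S} (h : IsIntegrallyClosedHom φ) (e : R ≃+* R') :
    IsIntegrallyClosedHom (φ.comp e.toRingHom) := by
  refine ⟨h.1.comp e.injective, fun c hc => ?_⟩
  obtain ⟨b, rfl⟩ := h.2 c (isIntegralElem_of_comp e.toRingHom rfl hc)
  exact ⟨e.symm b, by simp⟩

end IntegrallyClosedIn

section Normalization

lemma IsIntegrallyClosedHom.iso_comp {R S T : CommRingCat.{u}} {f : R ⟶ S} {g : S ⟶ T} [IsIso f]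
    (h : IsIntegrallyClosedHom g.hom) : IsIntegrallyClosedHom (f ≫ g).hom :=
  h.comp_equiv (asIso f).commRingCatIsoToRingEquiv

lemma IsIntegrallyClosedHom.comp_iso {R S T : CommRingCat.{u}} {f : R ⟶ S} {g : S ⟶ T} [IsIso g]
    (h : IsIntegrallyClosedHom f.hom) : IsIntegrallyClosedHom (f ≫ g).hom :=
  h.comp_bijective (asIso g).commRingCatIsoToRingEquiv.bijective

lemma isIntegrallyClosedHom_app_top {A L : CommRingCat.{u}} {φ : A ⟶ L}
    (h : IsIntegrallyClosedHom φ.hom) {W : (Spec A).Opens} (hW : W = ⊤) :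
    IsIntegrallyClosedHom ((Spec.map φ).app W).hom := by
  subst hW
  have : (Spec.map φ).appTop =
      (Scheme.ΓSpecIso A).hom ≫ φ ≫ (Scheme.ΓSpecIso L).inv := by
    rw [← Category.assoc, Iso.eq_comp_inv]
    exact Scheme.ΓSpecIso_naturality φ
  change IsIntegrallyClosedHom (Spec.map φ).appTop.hom
  rw [this]
  exact IsIntegrallyClosedHom.iso_comp (IsIntegrallyClosedHom.comp_iso h)

lemma isIntegrallyClosedHom_app_opensRange {Y : Scheme.{u}} {A L : CommRingCat.{u}} {φ : A ⟶ L}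
    (h : IsIntegrallyClosedHom φ.hom) (j : Spec A ⟶ Y) [IsOpenImmersion j] :
    IsIntegrallyClosedHom ((Spec.map φ ≫ j).app j.opensRange).hom := by
  rw [Scheme.Hom.comp_app]
  have := Scheme.Hom.isIso_app j j.opensRange le_rfl
  exact (isIntegrallyClosedHom_app_top h j.preimage_opensRange).iso_comp

/-- An integral morphism `d : N ⟶ Y` is an isomorphism if it is dominated by a morphism `Z ⟶ N`
that is injective on sections, and `Y` is locally integrally closed in `Z`. -/
lemma isIso_of_isIntegrallyClosedHom {Z N Y : Scheme.{u}} (h : Z ⟶ N) [QuasiCompact h]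
    (hker : h.ker = ⊥) (d : N ⟶ Y) [IsIntegralHom d] {ι : Type*} (V : ι → Y.affineOpens)
    (hV : ⨆ i, (V i : Y.Opens) = ⊤)
    (hcl : ∀ i, IsIntegrallyClosedHom ((h ≫ d).app (V i)).hom) : IsIso d := by
  refine (IsZariskiLocalAtTarget.iff_of_iSup_eq_top
    (P := MorphismProperty.isomorphisms Scheme.{u}) _ hV).2 fun i =>
      (isIso_morphismRestrict_iff_isIso_app d (V i).2).2 ?_
  rw [ConcreteCategory.isIso_iff_bijective]
  have hc := hcl i
  rw [Scheme.Hom.comp_app] at hc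
  -- A zero kernel ideal sheaf means that `h` is injective on sections over each affine open; the
  -- preimage of `V i` is affine because `d` is integral.
  have hinj : Function.Injective (h.app (d ⁻¹ᵁ (V i : Y.Opens))).hom := by
    have := Scheme.Hom.ker_apply h ⟨d ⁻¹ᵁ (V i : Y.Opens), (V i).2.preimage d⟩
    rw [hker] at this
    exact (RingHom.injective_iff_ker_eq_bot _).2 this.symm
  refine ⟨fun a b hab => hc.1 (congrArg (h.app _).hom hab), fun c => ?_⟩
  -- A section `c` over the preimage is integral over the sections on `V i`, hence so is its image
  -- in `Z`. That image comes from a section on `V i`, and injectivity identifies the latter with a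
  -- preimage of `c`.
  have hint := IsIntegralHom.isIntegral_app d (V i : Y.Opens) (V i).2 c
  obtain ⟨p, hp, hpc⟩ := hint
  obtain ⟨a, ha⟩ := hc.2 ((h.app _).hom c) ⟨p, hp, by
    have := congrArg (h.app (d ⁻¹ᵁ (V i : Y.Opens))).hom hpc
    rw [Polynomial.hom_eval₂, map_zero] at this
    exact this⟩
  exact ⟨a, hinj ha⟩

/-- The universal property of the relative normalization turns the factorization through the
integral `ψ` into a comparison map to `Y`. The generic point maps to the normalization with zero
kernel, so the preceding criterion shows that the comparison is an isomorphism. -/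
lemma isNormalization_of_isIntegrallyClosedHom {X Y : Scheme.{u}} [IsIntegral X] (ψ : Y ⟶ X)
    [IsIntegralHom ψ] (g : Spec (X.presheaf.stalk (genericPoint X)) ⟶ Y)
    (hg : X.fromSpecStalk (genericPoint X) = g ≫ ψ) {ι : Type*} (V : ι → Y.affineOpens)
    (hV : ⨆ i, (V i : Y.Opens) = ⊤) (hcl : ∀ i, IsIntegrallyClosedHom (g.app (V i)).hom) :
    IsNormalization ψ := by
  have : IsIso ((X.fromSpecStalk (genericPoint X)).normalizationDesc g ψ hg) := by
    refine isIso_of_isIntegrallyClosedHom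
      (X.fromSpecStalk (genericPoint X)).toNormalization (by simp) _ V hV fun i => ?_
    rw [Scheme.Hom.toNormalization_normalizationDesc]
    exact hcl i
  refine ⟨inferInstance,
    (asIso ((X.fromSpecStalk (genericPoint X)).normalizationDesc g ψ hg)).symm, ?_⟩
  rw [Iso.symm_hom, asIso_inv, IsIso.inv_comp_eq, Scheme.Hom.normalizationDesc_comp]

end Normalization

/-! ### Integrality and the function field of `Proj`. -/

section Proj

variable {A σ : Type u} [CommRing A] [SetLike σ A] [AddSubgroupClass σ A]
  {𝒜 : ℕ → σ} [GradedRing 𝒜]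

lemma isDomain_of_homogeneous [Nontrivial A]
    (h : ∀ {i j : ℕ} {a b : A}, a ∈ 𝒜 i → b ∈ 𝒜 j → a * b = 0 → a = 0 ∨ b = 0) : IsDomain A := by
  have : (⊥ : Ideal A).IsPrime := by
    refine Ideal.IsHomogeneous.isPrime_of_homogeneous_mem_or_mem (𝒜 := 𝒜)
      (Ideal.IsHomogeneous.bot 𝒜) bot_ne_top ?_
    rintro x y ⟨i, hi⟩ ⟨j, hj⟩ hxy
    exact h hi hj hxy
  exact IsDomain.of_bot_isPrime A

lemma isReduced_away [IsDomain A] (s : A) : _root_.IsReduced (Away 𝒜 s) := by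
  have : _root_.IsReduced (Localization.Away s) :=
    isReduced_localizationPreserves (.powers s) (Localization.Away s) inferInstance
  exact isReduced_of_injective (algebraMap (Away 𝒜 s) (Localization.Away s))
    (HomogeneousLocalization.val_injective _)

/-- The zero ideal is a point of `Proj`, as `t` keeps the irrelevant ideal from being zero, and it
is generic. Reducedness is checked on the charts. -/
lemma isIntegral_proj [IsDomain A] {d : ℕ} (hd : 0 < d) {t : A} (ht : t ∈ 𝒜 d) (ht0 : t ≠ 0) :
    IsIntegral (Proj 𝒜) := by
  let η : ProjectiveSpectrum 𝒜 := ⟨⊥, by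
    rw [HomogeneousIdeal.toIdeal_bot]
    exact Ideal.isPrime_bot, fun h => ht0 (by
      have h1 : t ∈ HomogeneousIdeal.irrelevant 𝒜 := by
        rw [HomogeneousIdeal.mem_irrelevant_iff, GradedRing.proj_apply,
          DirectSum.decompose_of_mem_ne 𝒜 ht hd.ne']
      have h2 : t ∈ (⊥ : HomogeneousIdeal 𝒜).toIdeal := h h1
      rwa [HomogeneousIdeal.toIdeal_bot] at h2)⟩
  have hη : closure ({η} : Set (ProjectiveSpectrum 𝒜)) = Set.univ := by
    refine Set.eq_univ_of_forall fun x => ?_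
    rw [← ProjectiveSpectrum.le_iff_mem_closure, ← ProjectiveSpectrum.as_ideal_le_as_ideal]
    exact bot_le
  have : IrreducibleSpace (Proj 𝒜) := by
    have h : IrreducibleSpace (ProjectiveSpectrum 𝒜) := by
      rw [irreducibleSpace_def, Set.top_eq_univ, ← hη]
      exact isIrreducible_singleton.closure
    exact h
  have (i : _) : IsReduced ((Proj.affineOpenCover 𝒜).openCover.X i) := by
    have := isReduced_away (𝒜 := 𝒜) (i.2 : A)
    exact inferInstanceAs (IsReduced (Spec (.of (Away 𝒜 (i.2 : A)))))
  have : IsReduced (Proj 𝒜) := IsReduced.of_openCover _ (Proj.affineOpenCover 𝒜).openCover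
  exact isIntegral_of_irreducibleSpace_of_isReduced _

lemma specMap_awayToSection_awayι {d : ℕ} (hd : 0 < d) {t : A} (ht : t ∈ 𝒜 d) :
    Spec.map (Proj.awayToSection 𝒜 t) ≫ Proj.awayι 𝒜 t ht hd =
      (Proj.isAffineOpen_basicOpen 𝒜 t ht hd).fromSpec := by
  have hU := Proj.isAffineOpen_basicOpen 𝒜 t ht hd
  rw [← cancel_epi hU.isoSpec.hom, IsAffineOpen.isoSpec_hom, IsAffineOpen.toSpecΓ_fromSpec,
    Proj.awayι, ← Category.assoc, ← Category.assoc]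
  have : ((Proj.basicOpen 𝒜 t).toSpecΓ ≫ Spec.map (Proj.awayToSection 𝒜 t)) =
      (Proj.basicOpenIsoSpec 𝒜 t ht hd).hom := rfl
  rw [this, Iso.hom_inv_id, Category.id_comp]

/-- The map from a chart to the function field. -/
def awayToFunctionField [IrreducibleSpace (Proj 𝒜)] (t : A) [Nonempty (Proj.basicOpen 𝒜 t)] :
    CommRingCat.of (Away 𝒜 t) ⟶ (Proj 𝒜).functionField :=
  Proj.awayToSection 𝒜 t ≫ (Proj 𝒜).germToFunctionField (Proj.basicOpen 𝒜 t)

lemma specMap_awayToFunctionField [IrreducibleSpace (Proj 𝒜)] {d : ℕ} (hd : 0 < d) {t : A}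
    (ht : t ∈ 𝒜 d) [Nonempty (Proj.basicOpen 𝒜 t)] :
    Spec.map (awayToFunctionField (𝒜 := 𝒜) t) ≫ Proj.awayι 𝒜 t ht hd =
      (Proj 𝒜).fromSpecStalk (genericPoint (Proj 𝒜)) := by
  rw [awayToFunctionField, Spec.map_comp, Category.assoc, specMap_awayToSection_awayι,
    ← (Proj.isAffineOpen_basicOpen 𝒜 t ht hd).fromSpecStalk_eq_fromSpecStalk]
  rfl

/-- `Away 𝒜 t` is the ring of sections on the affine open `D₊(t)`, and the function field of an
integral scheme is the fraction field of each nonempty affine open. -/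
lemma isFraction_awayToFunctionField [IsIntegral (Proj 𝒜)] {d : ℕ} (hd : 0 < d) {t : A}
    (ht : t ∈ 𝒜 d) [Nonempty (Proj.basicOpen 𝒜 t)] :
    Function.Injective (awayToFunctionField (𝒜 := 𝒜) t).hom ∧
    ∀ y : (Proj 𝒜).functionField, ∃ a b : Away 𝒜 t,
      (awayToFunctionField t).hom b ≠ 0 ∧
        y * (awayToFunctionField t).hom b = (awayToFunctionField t).hom a := by
  have hiso : Function.Bijective (Proj.awayToSection 𝒜 t).hom :=
    (Proj.basicOpenIsoAway 𝒜 t ht hd).commRingCatIsoToRingEquiv.bijective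
  have hfrac := functionField_isFractionRing_of_isAffineOpen _ (Proj.basicOpen 𝒜 t)
    (Proj.isAffineOpen_basicOpen 𝒜 t ht hd)
  refine ⟨((Proj 𝒜).germToFunctionField_injective _).comp hiso.1, fun y => ?_⟩
  obtain ⟨⟨a, b⟩, hab⟩ := IsLocalization.surj
    (nonZeroDivisors Γ(Proj 𝒜, Proj.basicOpen 𝒜 t)) y
  obtain ⟨a, rfl⟩ := hiso.2 a
  obtain ⟨b, hb⟩ := b
  obtain ⟨b, rfl⟩ := hiso.2 b
  exact ⟨a, b, IsFractionRing.to_map_ne_zero_of_mem_nonZeroDivisors hb, hab⟩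

end Proj

/-! ### Embedding the charts of `Proj` into a field. -/

section AwayEval

variable {B τ K : Type u} [CommRing B] [SetLike τ B] [AddSubgroupClass τ B] {ℬ : ℕ → τ}
  [GradedRing ℬ] [Field K] (φ : B →+* K)

/-- The evaluation of homogeneous fractions in a field. -/
def awayEval {s : B} (hs : φ s ≠ 0) : Away ℬ s →+* K :=
  (Localization.awayLift φ s (isUnit_iff_ne_zero.2 hs)).comp
    (algebraMap (Away ℬ s) (Localization.Away s))

variable {φ}

lemma awayEval_mk {s : B} (hs : φ s ≠ 0) {d : ℕ} (hd : s ∈ ℬ d) (n : ℕ) (b : B)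
    (hb : b ∈ ℬ (n • d)) : awayEval φ hs (Away.mk ℬ hd n b hb) * φ s ^ n = φ b := by
  change Localization.awayLift φ s (isUnit_iff_ne_zero.2 hs)
    (Localization.mk b ⟨s ^ n, n, rfl⟩) * _ = _
  rw [Localization.awayLift_mk (hv := mul_inv_cancel₀ hs), mul_assoc, ← mul_pow,
    inv_mul_cancel₀ hs, one_pow, mul_one]

/-- Injectivity of `φ` on each graded piece is enough, since a homogeneous fraction has a
homogeneous numerator. In the application `φ` forgets degrees and is not injective on the whole
ring. -/
lemma awayEval_injective (hφ : ∀ i, ∀ b ∈ ℬ i, φ b = 0 → b = 0) {s : B} (hs : φ s ≠ 0) {d : ℕ}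
    (hd : s ∈ ℬ d) : Function.Injective (awayEval (ℬ := ℬ) φ hs) := by
  refine (injective_iff_map_eq_zero _).2 fun x hx => ?_
  obtain ⟨n, b, hb, rfl⟩ := x.mk_surjective _ hd
  have h := awayEval_mk hs hd n b hb
  rw [hx, zero_mul] at h
  have h0 := hφ _ b hb h.symm
  refine HomogeneousLocalization.val_injective _ ?_
  rw [Away.val_mk, HomogeneousLocalization.val_zero, h0]
  exact Localization.mk_zero _

lemma awayEval_awayMap {s t x : B} (hs : φ s ≠ 0) {d e : ℕ} (hsd : s ∈ ℬ d) (hte : t ∈ ℬ e)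
    (hx : x = s * t) (hx0 : φ x ≠ 0) :
    (awayEval φ hx0).comp (awayMap ℬ hte hx) = awayEval (ℬ := ℬ) φ hs := by
  subst hx
  ext y
  obtain ⟨n, b, hb, rfl⟩ := y.mk_surjective _ hsd
  have h1 := awayEval_mk hs hsd n b hb
  have ht : φ t ≠ 0 := right_ne_zero_of_mul (map_mul φ s t ▸ hx0)
  rw [RingHom.comp_apply, awayMap_mk]
  refine mul_right_cancel₀ (pow_ne_zero n hx0) ?_
  rw [awayEval_mk, map_mul, map_mul, map_pow, mul_pow, ← mul_assoc, h1]

lemma isDomain_of_eval (hφ : ∀ i, ∀ b ∈ ℬ i, φ b = 0 → b = 0) : IsDomain B := by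
  have := φ.domain_nontrivial
  refine isDomain_of_homogeneous (𝒜 := ℬ) fun {i j a b} ha hb hab => ?_
  have h := congrArg φ hab
  rw [map_mul, map_zero] at h
  exact (mul_eq_zero.1 h).imp (hφ i a ha) (hφ j b hb)

/-- The `K`-point of `Proj` does not depend on the chart: both sides factor through `D₊(s t)`. -/
lemma specMap_awayEval_awayι {s t : B} (hs : φ s ≠ 0) (ht : φ t ≠ 0) {d e : ℕ} (hd : 0 < d)
    (he : 0 < e) (hsd : s ∈ ℬ d) (hte : t ∈ ℬ e) :
    Spec.map (CommRingCat.ofHom (awayEval (ℬ := ℬ) φ hs)) ≫ Proj.awayι ℬ s hsd hd =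
      Spec.map (CommRingCat.ofHom (awayEval (ℬ := ℬ) φ ht)) ≫ Proj.awayι ℬ t hte he := by
  have hst : φ (s * t) ≠ 0 := map_mul φ s t ▸ mul_ne_zero hs ht
  rw [← awayEval_awayMap hs hsd hte rfl hst,
    ← awayEval_awayMap ht hte hsd (mul_comm s t) hst, CommRingCat.ofHom_comp,
    CommRingCat.ofHom_comp, Spec.map_comp, Spec.map_comp, Category.assoc, Category.assoc,
    Proj.SpecMap_awayMap_awayι, Proj.SpecMap_awayMap_awayι]
  rfl

end AwayEval

/-! ### Finiteness and normalization for a morphism of `Proj`s. -/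

section ProjMap

variable {A B σ τ : Type u} [CommRing A] [SetLike σ A] [AddSubgroupClass σ A]
  [CommRing B] [SetLike τ B] [AddSubgroupClass τ B]
  {𝒜 : ℕ → σ} {ℬ : ℕ → τ} [GradedRing 𝒜] [GradedRing ℬ] {f : 𝒜 →+*ᵍ ℬ} (h : Dominates f)

/-- The equality is tested on the charts `D₊(f t)` covering the source, where both sides are cut out
by the same degree-zero fraction. -/
lemma projMap_preimage_basicOpen {d : ℕ} {s : A} (hs : s ∈ 𝒜 d) (hd : 0 < d) :
    projMap h ⁻¹ᵁ Proj.basicOpen 𝒜 s = Proj.basicOpen ℬ (f s) := by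
  ext x
  obtain ⟨i, hi, t, ht, hx⟩ := h x
  rw [← Proj.opensRange_awayι ℬ (f t) (Graded.map_mem f ht) hi] at hx
  obtain ⟨y, rfl⟩ := hx
  have key : Proj.awayι ℬ (f t) (Graded.map_mem f ht) hi ⁻¹ᵁ
      projMap h ⁻¹ᵁ Proj.basicOpen 𝒜 s =
      Proj.awayι ℬ (f t) (Graded.map_mem f ht) hi ⁻¹ᵁ Proj.basicOpen ℬ (f s) := by
    rw [← Scheme.Hom.comp_preimage, awayι_comp_projMap h ht hi, Scheme.Hom.comp_preimage,
      Proj.awayι_preimage_basicOpen 𝒜 ht hi hs hd,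
      Proj.awayι_preimage_basicOpen ℬ (Graded.map_mem f ht) hi (Graded.map_mem f hs) hd]
    have : Away.map f t (Away.isLocalizationElem ht hs) =
        Away.isLocalizationElem (Graded.map_mem f ht) (Graded.map_mem f hs) := by
      rw [Away.isLocalizationElem, Away.map_mk]
      simp only [map_pow]
    rw [← this]
    rfl
  exact Iff.of_eq (congrArg (y ∈ ·) key)

lemma isPullback_projMap {d : ℕ} {s : A} (hs : s ∈ 𝒜 d) (hd : 0 < d) :
    IsPullback (Spec.map (CommRingCat.ofHom (Away.map f s)))
      (Proj.awayι ℬ (f s) (Graded.map_mem f hs) hd) (Proj.awayι 𝒜 s hs hd) (projMap h) := by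
  refine IsOpenImmersion.isPullback _ _ _ _ (awayι_comp_projMap h hs hd) ?_
  rw [Proj.opensRange_awayι, Proj.opensRange_awayι, projMap_preimage_basicOpen h hs hd]

lemma isZariskiLocalAtTarget_of_hasAffineProperty {P : MorphismProperty Scheme.{u}}
    {Q : AffineTargetMorphismProperty} (hP : HasAffineProperty P Q) : IsZariskiLocalAtTarget P :=
  inferInstance

lemma isZariskiLocalAtTarget_isFinite :
    IsZariskiLocalAtTarget (@IsFinite.{u} : MorphismProperty Scheme.{u}) :=
  isZariskiLocalAtTarget_of_hasAffineProperty
    IsFinite.instHasAffinePropertyAndIsAffineFiniteCarrierObjOppositeOpensCarrierCarrierCommRingCatPresheafOpOpensTopHomAppTop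

/-- Finiteness is local on the target, and over the chart of `s` the morphism is `Spec` of the map
of charts. -/
lemma isFinite_projMap
    (hfin : ∀ d, 0 < d → ∀ s ∈ 𝒜 d, s ≠ 0 → (Away.map f s : Away 𝒜 s →+* _).Finite) :
    IsFinite (projMap h) := by
  have hloc := isZariskiLocalAtTarget_isFinite.{u}
  refine IsZariskiLocalAtTarget.of_openCover (P := @IsFinite)
    (Proj.affineOpenCover 𝒜).openCover fun i => ?_
  have hfi : (Away.map f (i.2 : A) : Away 𝒜 (i.2 : A) →+* _).Finite := by
    -- For `s = 0` the chart is empty: its ring is zero.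
    by_cases h0 : (i.2 : A) = 0
    · have : Subsingleton (Away ℬ (f (i.2 : A))) :=
        HomogeneousLocalization.subsingleton ℬ ⟨1, by
          rw [h0, map_zero]
          exact pow_one 0⟩
      exact RingHom.Finite.of_surjective _ fun y => ⟨0, Subsingleton.elim _ _⟩
    · exact hfin _ i.1.pos _ i.2.2 h0
  have := (isPullback_projMap h i.2.2 i.1.pos).flip
  have hiso : Limits.pullback.snd (projMap h) (Proj.awayι 𝒜 (i.2 : A) i.2.2 i.1.pos) =
      this.isoPullback.inv ≫ Spec.map (CommRingCat.ofHom (Away.map f (i.2 : A))) := by simp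
  change IsFinite (Limits.pullback.snd (projMap h) (Proj.awayι 𝒜 (i.2 : A) i.2.2 i.1.pos))
  rw [hiso]
  have := (IsFinite.SpecMap_iff (CommRingCat.ofHom (Away.map f (i.2 : A)))).2 hfi
  infer_instance

variable {K : Type u} [Field K] {φ : B →+* K}

lemma awayEval_comp_awayMap {d : ℕ} {s : A} (hs : s ∈ 𝒜 d) (hs0 : φ (f s) ≠ 0) :
    (awayEval (ℬ := ℬ) φ hs0).comp (Away.map f s) =
      awayEval (ℬ := 𝒜) (φ.comp (f : A →+* B)) hs0 := by
  ext y
  obtain ⟨n, b, hb, rfl⟩ := y.mk_surjective _ hs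
  refine mul_right_cancel₀ (pow_ne_zero n hs0) ?_
  rw [RingHom.comp_apply, Away.map_mk, awayEval_mk]
  exact (awayEval_mk (φ := φ.comp (f : A →+* B)) hs0 hs n b hb).symm

lemma nonempty_basicOpen {d : ℕ} {t : A} (ht : t ∈ 𝒜 d) (hd : 0 < d) [Nontrivial (Away 𝒜 t)] :
    Nonempty (Proj.basicOpen 𝒜 t) := by
  have : Nonempty (Spec (.of (Away 𝒜 t))) :=
    inferInstanceAs (Nonempty (PrimeSpectrum (Away 𝒜 t)))
  obtain ⟨x⟩ := this
  refine ⟨⟨Proj.awayι 𝒜 t ht hd x, ?_⟩⟩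
  rw [← Proj.opensRange_awayι 𝒜 t ht hd]
  exact ⟨x, rfl⟩

/-- Two fields of fractions of a ring are isomorphic over it. -/
lemma exists_bijective_comp_eq {R K L : Type*} [CommRing R] [Field K] [CommRing L] [Nontrivial L]
    {j : R →+* K} {κ : R →+* L} (hj : Function.Injective j) (hκ : ∀ b, b ≠ 0 → IsUnit (κ b))
    (hjfrac : ∀ y, ∃ a b, j b ≠ 0 ∧ y * j b = j a)
    (hκfrac : ∀ y, ∃ a b, b ≠ 0 ∧ y * κ b = κ a) :
    ∃ l : K →+* L, Function.Bijective l ∧ l.comp j = κ := by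
  have : IsDomain R := hj.isDomain j
  let : Algebra R K := j.toAlgebra
  have : FaithfulSMul R K := (faithfulSMul_iff_algebraMap_injective _ _).2 hj
  have : IsFractionRing R K := by
    refine IsFractionRing.of_field R K fun y => ?_
    obtain ⟨a, b, hb, hab⟩ := hjfrac y
    exact ⟨a, b, (eq_div_iff hb).2 hab⟩
  have hunit (b : nonZeroDivisors R) : IsUnit (κ b) := hκ b (nonZeroDivisors.coe_ne_zero b)
  have hcomp : (IsLocalization.lift (S := K) hunit).comp j = κ :=
    RingHom.ext fun x => IsLocalization.lift_eq hunit x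
  refine ⟨IsLocalization.lift (S := K) hunit, ⟨RingHom.injective _, fun y => ?_⟩, hcomp⟩
  obtain ⟨a, b, hb, hab⟩ := hκfrac y
  have hjb : j b ≠ 0 := fun h0 => hb (hj (h0.trans (map_zero j).symm))
  refine ⟨j a / j b, (hκ b hb).mul_right_cancel ?_⟩
  have ha := RingHom.congr_fun hcomp a
  have hb := RingHom.congr_fun hcomp b
  rw [RingHom.comp_apply] at ha hb
  rw [hab, ← ha, ← hb, ← map_mul, div_mul_cancel₀ _ hjb]

lemma specMap_awayEval_awayι_projMap {L : CommRingCat.{u}} {d : ℕ} (hd : 0 < d) {t : A}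
    (ht : t ∈ 𝒜 d) (ht0 : φ (f t) ≠ 0) (l : CommRingCat.of K ⟶ L)
    (κ : CommRingCat.of (Away 𝒜 t) ⟶ L)
    (hl : l.hom.comp (awayEval (ℬ := 𝒜) (φ.comp (f : A →+* B)) ht0) = κ.hom) :
    (Spec.map l ≫ Spec.map (CommRingCat.ofHom (awayEval (ℬ := ℬ) φ ht0)) ≫
      Proj.awayι ℬ (f t) (Graded.map_mem f ht) hd) ≫ projMap h =
    Spec.map κ ≫ Proj.awayι 𝒜 t ht hd := by
  rw [Category.assoc, Category.assoc, awayι_comp_projMap h ht hd, ← Spec.map_comp_assoc,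
    ← Spec.map_comp_assoc]
  congr 2
  rw [← Category.assoc, ← CommRingCat.ofHom_comp, awayEval_comp_awayMap ht ht0]
  ext x
  exact RingHom.congr_fun hl x

/-- The spectrum of the function field of the target maps to the source, through a chart on which
the function field is the field of fractions. -/
lemma exists_fromSpecStalk_factorization [IsIntegral (Proj 𝒜)]
    (hφ : ∀ i, ∀ a ∈ 𝒜 i, φ (f a) = 0 → a = 0)
    {d : ℕ} (hd : 0 < d) {t : A} (ht : t ∈ 𝒜 d) (ht0 : φ (f t) ≠ 0)
    (hfrac : ∀ y : K, ∃ a b : Away 𝒜 t,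
      awayEval (ℬ := 𝒜) (φ.comp (f : A →+* B)) ht0 b ≠ 0 ∧
      y * awayEval (ℬ := 𝒜) (φ.comp (f : A →+* B)) ht0 b =
        awayEval (ℬ := 𝒜) (φ.comp (f : A →+* B)) ht0 a) :
    ∃ l : CommRingCat.of K ⟶ (Proj 𝒜).functionField, Function.Bijective l.hom ∧
      (Proj 𝒜).fromSpecStalk (genericPoint (Proj 𝒜)) =
        (Spec.map l ≫ Spec.map (CommRingCat.ofHom (awayEval (ℬ := ℬ) φ ht0)) ≫
          Proj.awayι ℬ (f t) (Graded.map_mem f ht) hd) ≫ projMap h := by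
  have : Nontrivial (Away 𝒜 t) :=
    (awayEval (ℬ := 𝒜) (φ.comp (f : A →+* B)) ht0).domain_nontrivial
  have := nonempty_basicOpen ht hd
  obtain ⟨hκ, hκfrac⟩ := isFraction_awayToFunctionField (𝒜 := 𝒜) hd ht
  obtain ⟨l, hl, hlj⟩ := exists_bijective_comp_eq (L := (Proj 𝒜).functionField)
    (κ := (awayToFunctionField t).hom)
    (awayEval_injective (φ := φ.comp (f : A →+* B)) hφ ht0 ht)
    (fun b hb => isUnit_iff_ne_zero.2 ((map_ne_zero_iff _ hκ).2 hb)) hfrac fun y =>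
      (hκfrac y).imp fun a => Exists.imp fun b hab => ⟨(map_ne_zero_iff _ hκ).1 hab.1, hab.2⟩
  refine ⟨CommRingCat.ofHom l, hl, ?_⟩
  exact (specMap_awayToFunctionField hd ht).symm.trans
    (specMap_awayEval_awayι_projMap h hd ht ht0 (CommRingCat.ofHom l) _ hlj).symm

lemma isIntegrallyClosedHom_app_basicOpen {L : CommRingCat.{u}} {d : ℕ} (hd : 0 < d) {s : B}
    (hs : s ∈ ℬ d) {χ : CommRingCat.of (Away ℬ s) ⟶ L} (hχ : IsIntegrallyClosedHom χ.hom) :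
    IsIntegrallyClosedHom
      ((Spec.map χ ≫ Proj.awayι ℬ s hs hd).app (Proj.basicOpen ℬ s)).hom := by
  rw [← Proj.opensRange_awayι ℬ s hs hd]
  exact isIntegrallyClosedHom_app_opensRange hχ _

/-- A finite morphism of `Proj`s is the normalization if the charts of the source are integrally
closed in the quotient field of the charts of the target. -/
theorem isNormalization_projMap [IsIntegralHom (projMap h)]
    (hφ : ∀ i, ∀ a ∈ 𝒜 i, φ (f a) = 0 → a = 0) (hφ' : ∀ i, ∀ b ∈ ℬ i, φ b = 0 → b = 0)
    (hcl : ∀ d, 0 < d → ∀ s ∈ 𝒜 d, ∀ hs : φ (f s) ≠ 0, ∀ c,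
      (awayEval (ℬ := ℬ) φ hs).IsIntegralElem c → c ∈ (awayEval (ℬ := ℬ) φ hs).range)
    {d : ℕ} (hd : 0 < d) {t : A} (ht : t ∈ 𝒜 d) (ht0 : φ (f t) ≠ 0)
    (hfrac : ∀ y : K, ∃ a b : Away 𝒜 t,
      awayEval (ℬ := 𝒜) (φ.comp (f : A →+* B)) ht0 b ≠ 0 ∧
      y * awayEval (ℬ := 𝒜) (φ.comp (f : A →+* B)) ht0 b =
        awayEval (ℬ := 𝒜) (φ.comp (f : A →+* B)) ht0 a) :
    IsNormalization (projMap h) := by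
  have : IsDomain A := isDomain_of_eval (φ := φ.comp (f : A →+* B)) hφ
  have hft0 : t ≠ 0 := fun h0 => ht0 (by rw [h0, map_zero, map_zero])
  have : IsIntegral (Proj 𝒜) := isIntegral_proj hd ht hft0
  obtain ⟨l, hl, hg⟩ := exists_fromSpecStalk_factorization h hφ hd ht ht0 hfrac
  -- Charts on which `φ` kills the denominator are left out: there `f s = 0` and the chart is empty.
  let ι := {i : Σ i : PNat, 𝒜 i // φ (f (i.2 : A)) ≠ 0}
  let V : ι → (Proj ℬ).affineOpens := fun i => ⟨Proj.basicOpen ℬ (f (i.1.2 : A)),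
    Proj.isAffineOpen_basicOpen ℬ _ (Graded.map_mem f i.1.2.2) i.1.1.pos⟩
  refine isNormalization_of_isIntegrallyClosedHom (projMap h) _ hg V ?_ fun i => ?_
  · refine top_le_iff.1 fun x _ => ?_
    obtain ⟨i, hi, s, hs, hx⟩ := h x
    rw [TopologicalSpace.Opens.mem_iSup]
    refine ⟨⟨⟨⟨i, hi⟩, ⟨s, hs⟩⟩, fun h0 => ?_⟩, hx⟩
    have : f s = 0 := hφ' _ _ (Graded.map_mem f hs) h0
    rw [this, Proj.basicOpen_zero] at hx
    exact hx
  · obtain ⟨⟨⟨e, he⟩, ⟨s, hs⟩⟩, hs0⟩ := i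
    change IsIntegrallyClosedHom (Scheme.Hom.app _ (Proj.basicOpen ℬ (f s))).hom
    -- The generic point was built through the chart of `t`; it is rewritten through the chart of
    -- `s`, where it is `Spec` of the embedding of that chart into the function field.
    rw [← specMap_awayEval_awayι hs0 ht0 he hd (Graded.map_mem f hs) (Graded.map_mem f ht),
      ← Spec.map_comp_assoc]
    exact isIntegrallyClosedHom_app_basicOpen he (Graded.map_mem f hs)
      (IsIntegrallyClosedHom.comp_bijective
        ⟨awayEval_injective hφ' hs0 (Graded.map_mem f hs), hcl e he s hs hs0⟩ hl)

end ProjMap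

/-! ### The graded ring of a filtration and its charts inside the quotient field. -/

section BlowupEval

variable {S K : Type u} [CommRing S] [Algebra ℂ S] {R : Subalgebra ℂ S} [Field K] (j : R →+* K)
  {F G : ℕ → Submodule ℂ S} [SetLike.GradedMonoid F] [SetLike.GradedMonoid G]

lemma homog_mem_piece (n : ℕ) (u : F n) : homog F n u ∈ piece F n := ⟨u, rfl⟩

/-- The map that sends an element of degree `n`, given by `u ∈ F n ⊆ R`, to the image of `u`. -/
def blowupEval (hF : ∀ n, F n ≤ Subalgebra.toSubmodule R) : Blowup F →+* K :=
  DirectSum.toSemiring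
    (fun n => j.toAddMonoidHom.comp (Submodule.inclusion (hF n)).toAddMonoidHom)
    (map_one j) fun x y => map_mul j ⟨x, hF _ x.2⟩ ⟨y, hF _ y.2⟩

/-- `φ` sends the element `u ∈ F n`, in any degree `n`, to the image of `u`. -/
def IsEval (hF : ∀ n, F n ≤ Subalgebra.toSubmodule R) (φ : Blowup F →+* K) : Prop :=
  ∀ n u, φ (homog F n u) = j ⟨u, hF n u.2⟩

lemma isEval_blowupEval (hF : ∀ n, F n ≤ Subalgebra.toSubmodule R) :
    IsEval j hF (blowupEval j hF) := fun n u =>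
  DirectSum.toAddMonoid_of (β := fun n => F n) (fun n =>
    j.toAddMonoidHom.comp (Submodule.inclusion (hF n)).toAddMonoidHom) n u

variable {j} {hF : ∀ n, F n ≤ Subalgebra.toSubmodule R} {φ : Blowup F →+* K}

lemma IsEval.eq_zero (hφ : IsEval j hF φ) (hj : Function.Injective j)
    (n : ℕ) (b : Blowup F) (hb : b ∈ piece F n) (h : φ b = 0) : b = 0 := by
  obtain ⟨u, rfl⟩ := hb
  rw [hφ, map_eq_zero_iff _ hj] at h
  have : u = 0 := Subtype.ext (congrArg (Subtype.val : R → S) h)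
  rw [this, map_zero]

lemma IsEval.comp_blowupIncl {hG : ∀ n, G n ≤ Subalgebra.toSubmodule R} {φ : Blowup G →+* K}
    (hφ : IsEval j hG φ) (h : ∀ n, F n ≤ G n) :
    IsEval j (fun n => (h n).trans (hG n))
      (φ.comp (blowupIncl h : Blowup F →+* Blowup G)) := fun n u =>
  (congrArg φ (blowupIncl_homog h n u)).trans (hφ n (Submodule.inclusion (h n) u))

/-- This matches the abstract chart of `Proj` with the concrete ring of fractions `u a⁻ⁿ` in `K`. -/
lemma IsEval.mem_range_awayEval_iff (hφ : IsEval j hF φ) {m : ℕ} {a : F m} {s : Blowup F}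
    (hs : s = homog F m a) (hs0 : φ s ≠ 0) (x : K) :
    x ∈ (awayEval (ℬ := piece F) φ hs0).range ↔
      ∃ n, ∃ u : R, (u : S) ∈ F (n * m) ∧ x * j ⟨a, hF m a.2⟩ ^ n = j u := by
  subst hs
  rw [← hφ]
  constructor
  · rintro ⟨y, rfl⟩
    obtain ⟨n, b, hb, rfl⟩ := y.mk_surjective _ (homog_mem_piece m a)
    have h := awayEval_mk hs0 (homog_mem_piece m a) n b hb
    obtain ⟨u, rfl⟩ := hb
    exact ⟨n, ⟨u, hF _ u.2⟩, u.2, h.trans (hφ _ u)⟩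
  · rintro ⟨n, u, hu, hx⟩
    refine ⟨Away.mk (piece F) (homog_mem_piece m a) n (homog F (n * m) ⟨u, hu⟩)
      (homog_mem_piece _ _), ?_⟩
    refine mul_right_cancel₀ (pow_ne_zero n hs0) ?_
    rw [awayEval_mk, hx, hφ]

end BlowupEval

/-- A ring homomorphism is finite if it corresponds to a finite inclusion of subalgebras. -/
lemma finite_of_range {A B K : Type*} [CommRing A] [CommRing B] [CommRing K] [Algebra ℂ K]
    {f : A →+* B} {e : B →+* K} (he : Function.Injective e) {S T : Subalgebra ℂ K} (hST : S ≤ T)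
    (hfin : (Subalgebra.inclusion hST).toRingHom.Finite) (hS : ∀ x, x ∈ (e.comp f).range ↔ x ∈ S)
    (hT : ∀ x, x ∈ e.range ↔ x ∈ T) : f.Finite := by
  let eT : B ≃+* T := RingEquiv.ofBijective (e.codRestrict T fun b => (hT _).1 ⟨b, rfl⟩)
    ⟨fun a b hab => he (congrArg Subtype.val hab), fun x => by
      obtain ⟨b, hb⟩ := (hT x).2 x.2
      exact ⟨b, Subtype.ext hb⟩⟩
  let p : A →+* S := (e.comp f).codRestrict S fun a => (hS _).1 ⟨a, rfl⟩
  have hp : Function.Surjective p := fun x => by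
    obtain ⟨a, ha⟩ := (hS x).2 x.2
    exact ⟨a, Subtype.ext ha⟩
  -- Through `e`, the map `f` becomes a surjection onto `S`, the inclusion into `T`, and an
  -- isomorphism; all three are finite.
  have hf : f = (eT.symm.toRingHom.comp (Subalgebra.inclusion hST).toRingHom).comp p := by
    ext a
    refine eT.injective ((Subtype.ext ?_ : eT (f a) = Subalgebra.inclusion hST (p a)).trans
      (eT.apply_symm_apply _).symm)
    rfl
  rw [hf]
  exact ((RingHom.Finite.of_surjective _ eT.symm.surjective).comp hfin).comp
    (RingHom.Finite.of_surjective _ hp)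

section BlowupProj

variable {S K : Type u} [CommRing S] [Algebra ℂ S] {R : Subalgebra ℂ S} [Field K] [Algebra ℂ K]
  {j : R →+* K} {F G : ℕ → Submodule ℂ S} [SetLike.GradedMonoid F] [SetLike.GradedMonoid G]

/-- `T` is the subring of the elements `u a⁻ⁿ` of `K`, with `n ≥ 0` and `u ∈ F (n m)`. -/
def IsChart (j : R →+* K) (F : ℕ → Submodule ℂ S) (m : ℕ) (a : R) (T : Subalgebra ℂ K) : Prop :=
  ∀ x, x ∈ T ↔ ∃ n, ∃ u : R, (u : S) ∈ F (n * m) ∧ x * j a ^ n = j u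

theorem isFinite_projMap_blowupIncl (hj : Function.Injective j)
    (hG : ∀ n, G n ≤ Subalgebra.toSubmodule R) (h : ∀ n, F n ≤ G n)
    (hdom : Dominates (blowupIncl h))
    (hfin : ∀ m (a : R), (a : S) ∈ F m → ∃ (T T' : Subalgebra ℂ K) (hT : T ≤ T'),
      (Subalgebra.inclusion hT).toRingHom.Finite ∧ IsChart j F m a T ∧ IsChart j G m a T') :
    IsFinite (projMap hdom) := by
  have hφ := isEval_blowupEval j hG
  have hφ' := hφ.comp_blowupIncl h
  refine isFinite_projMap hdom fun d _ s hs hs0 => ?_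
  have hs1 : blowupEval j hG (blowupIncl h s) ≠ 0 := fun h0 => hs0 (hφ'.eq_zero hj d s hs h0)
  obtain ⟨u, rfl⟩ := hs
  obtain ⟨T, T', hT, hTT', hTF, hTG⟩ := hfin d ⟨u, hG d (h d u.2)⟩ u.2
  refine finite_of_range (awayEval_injective (hφ.eq_zero hj) hs1
    (Graded.map_mem (blowupIncl h) (homog_mem_piece d u))) hT hTT' (fun x => ?_) fun x => ?_
  · rw [awayEval_comp_awayMap (homog_mem_piece d u) hs1]
    exact (hφ'.mem_range_awayEval_iff rfl hs1 x).trans (hTF x).symm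
  · exact (hφ.mem_range_awayEval_iff (blowupIncl_homog h d u) hs1 x).trans (hTG x).symm

theorem isNormalization_projMap_blowupIncl (hj : Function.Injective j)
    (hG : ∀ n, G n ≤ Subalgebra.toSubmodule R) (h : ∀ n, F n ≤ G n)
    (hdom : Dominates (blowupIncl h)) [IsIntegralHom (projMap hdom)]
    (hcl : ∀ m (a : R), 1 ≤ m → (a : S) ∈ F m → a ≠ 0 → ∃ T : Subalgebra ℂ K, IsChart j G m a T ∧
      ∀ y, (algebraMap T K).IsIntegralElem y → y ∈ T)
    (h1 : 1 ∈ F 1) (hfrac : ∀ y : K, ∃ (n : ℕ) (f g : R), (f : S) ∈ F n ∧ (g : S) ∈ F n ∧ g ≠ 0 ∧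
      y * j g = j f) :
    IsNormalization (projMap hdom) := by
  have hφ := isEval_blowupEval j hG
  have hφ' := hφ.comp_blowupIncl h
  -- The element `1` placed in degree one serves as `t`. Its chart is the union of all `F n`, so a
  -- fraction of elements of the filtration is a fraction of elements of this chart.
  have h1' : (blowupEval j hG).comp (blowupIncl h : Blowup F →+* Blowup G)
      (homog F 1 ⟨1, h1⟩) = 1 := (hφ' 1 ⟨1, h1⟩).trans (map_one j)
  have ht0 : blowupEval j hG (blowupIncl h (homog F 1 ⟨1, h1⟩)) ≠ 0 := fun h0 =>
    one_ne_zero (h1'.symm.trans h0)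
  refine isNormalization_projMap hdom (φ := blowupEval j hG) (hφ'.eq_zero hj) (hφ.eq_zero hj)
    (fun d hd s hs hs0 c hc => ?_) one_pos (homog_mem_piece 1 ⟨1, h1⟩) ht0 fun y => ?_
  · obtain ⟨u, rfl⟩ := hs
    have ha0 : (⟨u, hG d (h d u.2)⟩ : R) ≠ 0 := fun h0 => hs0 <|
      (hφ' d u).trans ((congrArg j h0).trans (map_zero j))
    obtain ⟨T, hT, hTcl⟩ := hcl d ⟨u, hG d (h d u.2)⟩ hd u.2 ha0
    have hmem (x : K) : x ∈ (awayEval (ℬ := piece G) (blowupEval j hG) hs0).range ↔ x ∈ T :=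
      (hφ.mem_range_awayEval_iff (blowupIncl_homog h d u) hs0 x).trans (hT x).symm
    exact (hmem c).2 (hTcl c (isIntegralElem_of_comp
      (RingHom.codRestrict _ T fun b => (hmem _).1 ⟨b, rfl⟩) rfl hc))
  · obtain ⟨n, f, g, hf, hg, hg0, hfg⟩ := hfrac y
    have key (w : R) (hw : (w : S) ∈ F n) : ∃ b, awayEval (ℬ := piece F)
        ((blowupEval j hG).comp (blowupIncl h : Blowup F →+* Blowup G)) (s := homog F 1 ⟨1, h1⟩)
        ht0 b = j w := by
      refine (hφ'.mem_range_awayEval_iff rfl ht0 _).2 ⟨n, w, by rwa [mul_one], ?_⟩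
      have : j ⟨1, hG 1 (h 1 h1)⟩ = 1 := map_one j
      rw [this, one_pow, mul_one]
    obtain ⟨a, ha⟩ := key f hf
    obtain ⟨b, hb⟩ := key g hg
    refine ⟨a, b, ?_, ?_⟩
    · rw [hb]
      exact fun h0 => hg0 (hj (h0.trans (map_zero j).symm))
    · rw [ha, hb, hfg]

end BlowupProj

/-! ### Application to `ψ : C ⟶ C'`. -/

section Surface

variable {X : Type u} [TopologicalSpace X] [T2Space X] {pInf : X} [ChartedSpace ℂ X]
  [IsManifold 𝓘(ℂ) ω X] [PreconnectedSpace X] {z : LocalCoordinate pInf}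

lemma poleFiltration_le (n : ℕ) :
    poleFiltration z n ≤ Subalgebra.toSubmodule (functionRing z) := fun _ hf => hf.1

lemma algebraMap_functionField_injective :
    Function.Injective (algebraMap (functionRing z) (functionField z)) :=
  IsFractionRing.injective _ _

end Surface

namespace VertexData

variable {X : Type u} [TopologicalSpace X] [T2Space X] {pInf : X} [ChartedSpace ℂ X]
  [IsManifold 𝓘(ℂ) ω X] [PreconnectedSpace X] {z : LocalCoordinate pInf}
  {E : X → Type v} [∀ x, AddCommGroup (E x)] [∀ x, Module ℂ (E x)]
  [∀ x, TopologicalSpace (E x)] [TopologicalSpace (Bundle.TotalSpace ℂ E)]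
  [FiberBundle ℂ E] [VectorBundle ℂ ℂ E] {N M : ℕ} (D : VertexData z E N M)

lemma exists_isChart (m : ℕ) (a : functionRing z)
    (ha : (a : puncture pInf → ℂ) ∈ D.ReFiltration m) :
    ∃ (T T' : Subalgebra ℂ (functionField z)) (hT : T ≤ T'),
      (Subalgebra.inclusion hT).toRingHom.Finite ∧
      IsChart (algebraMap (functionRing z) (functionField z)) D.ReFiltration m a T ∧
      IsChart (algebraMap (functionRing z) (functionField z)) (poleFiltration z) m a T' :=
  ⟨chartRing D.ReFiltration ha, chartRing (poleFiltration z) (D.ReFiltration_le _ ha),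
    chartRing_mono D.ReFiltration_le ha, D.finite_inclusion_chartRing ha, fun _ => Iff.rfl,
    fun _ => Iff.rfl⟩

lemma exists_isChart_isIntegrallyClosed (m : ℕ) (a : functionRing z) (hm : 1 ≤ m)
    (ha : (a : puncture pInf → ℂ) ∈ D.ReFiltration m) (ha0 : a ≠ 0) :
    ∃ T : Subalgebra ℂ (functionField z),
      IsChart (algebraMap (functionRing z) (functionField z)) (poleFiltration z) m a T ∧
      ∀ y, (algebraMap T (functionField z)).IsIntegralElem y → y ∈ T :=
  ⟨chartRing (poleFiltration z) (D.ReFiltration_le m ha), fun _ => Iff.rfl,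
    fun _ hy => mem_chartRing_of_isIntegralElem _ hm ha0 hy⟩

lemma isFinite_projMap_dominates : IsFinite (projMap D.dominates) :=
  isFinite_projMap_blowupIncl (K := functionField z)
    (j := algebraMap (functionRing z) (functionField z))
    algebraMap_functionField_injective poleFiltration_le D.ReFiltration_le D.dominates
    D.exists_isChart

lemma isFinite_ψ : IsFinite D.ψ := D.isFinite_projMap_dominates

lemma ReFiltration_mono {m n : ℕ} (h : m ≤ n) : D.ReFiltration m ≤ D.ReFiltration n :=
  inf_le_inf_right _ (poleFiltration_mono h)

lemma exists_mul_eq_of_ReFiltration (y : functionField z) :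
    ∃ (n : ℕ) (f g : functionRing z), (f : puncture pInf → ℂ) ∈ D.ReFiltration n ∧
      (g : puncture pInf → ℂ) ∈ D.ReFiltration n ∧ g ≠ 0 ∧
      y * algebraMap (functionRing z) (functionField z) g =
        algebraMap (functionRing z) (functionField z) f := by
  obtain ⟨f, g, hf, hg, hg0, h⟩ := D.exists_mul_eq_of_Re y
  obtain ⟨k, hk⟩ := exists_mem_poleFiltration f
  obtain ⟨l, hl⟩ := exists_mem_poleFiltration g
  exact ⟨max k l, f, g, ⟨poleFiltration_mono (le_max_left k l) hk, hf⟩,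
    ⟨poleFiltration_mono (le_max_right k l) hl, hg⟩, hg0, h⟩

lemma isNormalization_projMap_dominates : IsNormalization (projMap D.dominates) := by
  have := D.isFinite_projMap_dominates
  have h1 : 1 ∈ D.ReFiltration 1 := one_mem_filtration (fun n => D.ReFiltration_mono n.le_succ) 1
  exact isNormalization_projMap_blowupIncl (K := functionField z)
    (j := algebraMap (functionRing z) (functionField z))
    algebraMap_functionField_injective poleFiltration_le D.ReFiltration_le D.dominates
    D.exists_isChart_isIntegrallyClosed h1 D.exists_mul_eq_of_ReFiltration

lemma isNormalization_ψ : IsNormalization D.ψ := D.isNormalization_projMap_dominates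

/-- One direction is the integral closedness of `R`; the other is that a finite extension is
integral. -/
lemma isIntegralElem_iff_mem_range (x : functionField z) :
    ((algebraMap (functionRing z) (functionField z)).comp
      (Subalgebra.inclusion D.Re_le).toRingHom).IsIntegralElem x ↔
    x ∈ (algebraMap (functionRing z) (functionField z)).range := by
  constructor
  · intro h
    exact IsIntegrallyClosed.isIntegral_iff.1
      (isIntegralElem_of_comp (Subalgebra.inclusion D.Re_le).toRingHom rfl h)
  · rintro ⟨y, rfl⟩
    obtain ⟨p, hp, h⟩ := D.finite_inclusion_Re.to_isIntegral y
    exact ⟨p, hp, by rw [← Polynomial.hom_eval₂, h, map_zero]⟩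

lemma isIntegralElem_iff_mem_chartRing {m : ℕ} {a : functionRing z}
    (ha : (a : puncture pInf → ℂ) ∈ D.ReFiltration m) (hm : 1 ≤ m) (ha0 : a ≠ 0)
    (x : functionField z) :
    (algebraMap (chartRing D.ReFiltration ha) (functionField z)).IsIntegralElem x ↔
      x ∈ chartRing (poleFiltration z) (D.ReFiltration_le m ha) := by
  constructor
  · exact fun hx => mem_chartRing_of_isIntegralElem _ hm ha0
      (isIntegralElem_of_comp (Subalgebra.inclusion (chartRing_mono D.ReFiltration_le ha)).toRingHom
        rfl hx)
  · intro hx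
    obtain ⟨p, hp, h⟩ := (D.finite_inclusion_chartRing ha).to_isIntegral ⟨x, hx⟩
    refine ⟨p, hp, ?_⟩
    have := congrArg (chartRing (poleFiltration z) (D.ReFiltration_le m ha)).val.toRingHom h
    rw [Polynomial.hom_eval₂, map_zero] at this
    exact this

end VertexData

end VertexCurve

end

theorem mainTheorem3 {X : Type u} [TopologicalSpace X] [T2Space X] [CompactSpace X]
    [ConnectedSpace X] [ChartedSpace ℂ X] [IsManifold 𝓘(ℂ) ω X]
    (E : X → Type v) [∀ x, AddCommGroup (E x)] [∀ x, Module ℂ (E x)]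
    [∀ x, TopologicalSpace (E x)] [TopologicalSpace (Bundle.TotalSpace ℂ E)]
    [FiberBundle ℂ E] [VectorBundle ℂ ℂ E] [ContMDiffVectorBundle ω ℂ E 𝓘(ℂ)]
    (pInf : X) (z : VertexCurve.LocalCoordinate pInf)
    (N M : ℕ) (D : VertexCurve.VertexData z E N M) :
    -- the morphism from `C` to `C'` is finite, and it is the normalization of the integral scheme
    VertexCurve.IsNormalization D.ψ ∧ IsFinite D.ψ ∧
    -- `R` is a finite `R_e`-module and the integral closure of `R_e` in `K`
    (Subalgebra.inclusion D.Re_le).toRingHom.Finite ∧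
    (∀ x : VertexCurve.functionField z,
      ((algebraMap (VertexCurve.functionRing z) (VertexCurve.functionField z)).comp
        (Subalgebra.inclusion D.Re_le).toRingHom).IsIntegralElem x ↔
      x ∈ (algebraMap (VertexCurve.functionRing z) (VertexCurve.functionField z)).range) ∧
    -- the same on the chart at infinity defined by `a ∈ R_e(m)` with a pole of exact order `m ≥ 1`
    ∀ (m : ℕ) (a : VertexCurve.functionRing z) (ha : (a : VertexCurve.puncture pInf → ℂ) ∈
        D.ReFiltration m), 1 ≤ m →
      (a : VertexCurve.puncture pInf → ℂ) ∉ VertexCurve.poleFiltration z (m - 1) →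
      (Subalgebra.inclusion
        (VertexCurve.chartRing_mono D.ReFiltration_le ha)).toRingHom.Finite ∧
      ∀ x : VertexCurve.functionField z,
        (algebraMap (VertexCurve.chartRing D.ReFiltration ha)
          (VertexCurve.functionField z)).IsIntegralElem x ↔
        x ∈ VertexCurve.chartRing (VertexCurve.poleFiltration z) (D.ReFiltration_le m ha) := by
  -- The exact pole order enters only to ensure `a ≠ 0`; charts with a smaller pole are integrally
  -- closed as well.
  refine ⟨D.isNormalization_ψ, D.isFinite_ψ, D.finite_inclusion_Re, D.isIntegralElem_iff_mem_range,
    fun m a ha hm hpole => ⟨D.finite_inclusion_chartRing ha,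
      D.isIntegralElem_iff_mem_chartRing ha hm fun h0 => hpole ?_⟩⟩
  rw [h0]
  exact zero_mem _
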